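/- **Setting.** A measurement pattern $\mathfrak P=(V,I,O,\lambda,S)$ consists of a finite set $V$ of qubits, sets $I,O\subseteq V$ of inputs and outputs (possibly overlapping), a map $\lambda:O^c\to\{(X,Y),(X,Z),(Y,Z)\}$, and a finite sequence $S$ of commands of the following kinds: preparation $N_i$ of qubit $i$ in $|+\rangle$; controlled-$Z$ operators $E_{ij}$ ($i\ne j$); destructive measurements $M_i$ of qubit $i$ in the basis $|\pm_{\lambda(i),\alpha_i}\rangle$ with angle $\alpha_i\in[0,\pi]$ and outcome $s_i\in\{0,1\}$ ($0$ for $+$, $1$ for $-$); dependent Pauli corrections $X_i^{s_j}$ and $Z_i^{s_j}$. Here $|\pm_{(X,Y),\alpha}\rangle=|\pm_{\pi/2,\alpha}\rangle$, $|\pm_{(X,Z),\alpha}\rangle=|\pm_{\alpha,0}\rangle$, $|\pm_{(Y,Z),\alpha}\rangle=|\pm_{\alpha,\pi/2}\rangle$, where $|+_{\theta,\phi}\rangle=\cos\frac\theta2|0\rangle+e^{i\phi}\sin\frac\theta2|1\rangle$, $|-_{\theta,\phi}\rangle=\sin\frac\theta2|0\rangle-e^{i\phi}\cos\frac\theta2|1\rangle$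 and $|+\rangle=|+_{\pi/2,0}\rangle$. The pattern is runnable: no command depends on an outcome not yet measured; no command acts on a qubit already measured or not yet prepared (a preparation acts on a qubit that has not existed before); a qubit is prepared if and only if it is not an input, and measured if and only if it is not an output. For each string $\mathbf s\in\{0,1\}^{O^c}$ of outcomes let $A_{\mathbf s}:\mathcal H_I\to\mathcal H_O$ be the linear map given by executing $S$ along the branch with outcomes $\mathbf s$, and let $T(\rho)=\sum_{\mathbf s}A_{\mathbf s}\rho A_{\mathbf s}^\dagger$; the pattern realizes $T$. It is *deterministic* if $T$ sends pure states to pure states; *strongly deterministic* if all the maps $A_{\mathbf s}$ are equal up to global phases; *stepwise deterministic* if for every $k\ge1$ (up to the number of measurements) the pattern in which only the first $k$ measurements of $S$ are performed, together with all the corrections depending on their outcomes, and whose outputs are the qubits that are not measured, is deterministic. It is *uniformly, strongly and stepwise deterministic* if it is deterministic, strongly deterministic and stepwise deterministic for all values $\alpha_i\in[0,\pi]$ of the measurement angles. The underlying graph $G$ of $\mathfrak P$ has vertex set $V$ and an edge $i\sim j$ whenever $E_{ij}$ occurs in $S$ (an odd number of times, as $E_{ij}^2=1$). Let $E_G=\prod_{i\sim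 j}E_{ij}$ and $N_{I^c}=\prod_{i\in I^c}N_i$, and for $K\subseteq V$ let $\mathrm{Odd}(K)=\{u\in V: |N_G(u)\cap K|\text{ is odd}\}$, where $N_G(u)$ is the set of neighbours of $u$. The open graph state $(G,I,O,\lambda)$ has a *generalized flow* if there are a map $g$ from $O^c$ to the subsets of $I^c$ and a partial order $<$ on $V$ such that for all $i\in O^c$: - (G1) if $j\in g(i)$ and $j\ne i$ then $i<j$; - (G2) if $j\le i$ and $j\ne i$ then $j\notin\mathrm{Odd}(g(i))$; - (G3) if $\lambda(i)=(X,Y)$ then $i\notin g(i)$ and $i\in\mathrm{Odd}(g(i))$; - (G4) if $\lambda(i)=(X,Z)$ then $i\in g(i)$ and $i\in\mathrm{Odd}(g(i))$; - (G5) if $\lambda(i)=(Y,Z)$ then $i\in g(i)$ and $i\notin\mathrm{Odd}(g(i))$. **Theorem.** Suppose that the runnable pattern $\mathfrak P$ is uniformly, strongly and stepwise deterministic. Then its underlying open graph state $(G,I,O,\lambda)$ has a generalized flow. Moreover, for all angles $\alpha_i\in[0,\pi]$, the pattern realizes the unitary embedding $$U_G=\Big(\prod_{i\in O^c}\langle +_{\lambda(i),\alpha_i}|_i\Big)\,E_G\,N_{I^c},$$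 that is: every branch map $A_{\mathbf s}$ is equal to $U_G$ up to a global phase, the normalized map $W=2^{|O^c|/2}\,U_G:\mathcal H_I\to\mathcal H_O$ is an isometry, and $T(\rho)=W\rho W^\dagger$ for all $\rho$. -/

import Mathlib

open scoped Matrix

noncomputable section

namespace MBQC

/-- The three measurement planes of the Bloch sphere. -/
inductive Plane where
  | XY
  | XZ
  | YZ

/-! ### Single-qubit states

A vector of the space of one qubit is a function `Bool → ℂ`, with `false` for the basis state
`|0⟩` and `true` for `|1⟩`. The space of a family of qubits indexed by `A` is `(A → Bool) → ℂ`. -/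

/-- `|+_{θ,φ}⟩ = cos(θ/2)|0⟩ + e^{iφ} sin(θ/2)|1⟩`. -/
def ketPlus (θ φ : ℝ) : Bool → ℂ
  | false => (Real.cos (θ / 2) : ℂ)
  | true => Complex.exp (Complex.I * φ) * (Real.sin (θ / 2) : ℂ)

/-- `|-_{θ,φ}⟩ = sin(θ/2)|0⟩ - e^{iφ} cos(θ/2)|1⟩`. -/
def ketMinus (θ φ : ℝ) : Bool → ℂ
  | false => (Real.sin (θ / 2) : ℂ)
  | true => -(Complex.exp (Complex.I * φ) * (Real.cos (θ / 2) : ℂ))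

/-- The preparation state `|+⟩ = |+_{π/2,0}⟩`. -/
def plusState : Bool → ℂ := ketPlus (Real.pi / 2) 0

/-- The measurement vector of the plane `l` at angle `a`; outcome `false` (that is, `0`) belongs
to `|+_{l,a}⟩` and outcome `true` (that is, `1`) to `|-_{l,a}⟩`. -/
def measKet (l : Plane) (a : ℝ) (b : Bool) : Bool → ℂ :=
  match l with
  | .XY => if b then ketMinus (Real.pi / 2) a else ketPlus (Real.pi / 2) a
  | .XZ => if b then ketMinus a 0 else ketPlus a 0
  | .YZ => if b then ketMinus a (Real.pi / 2) else ketPlus a (Real.pi / 2)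

/-- The basis state `|0⟩`. -/
def ketZero : Bool → ℂ
  | false => 1
  | true => 0

/-- The Pauli operator `X`. -/
def pauliX : Matrix Bool Bool ℂ := Matrix.of fun a b => if a = !b then 1 else 0

/-- The Pauli operator `Z`. -/
def pauliZ : Matrix Bool Bool ℂ := Matrix.diagonal fun a => if a then -1 else 1

section Register

variable {V : Type*} [Fintype V] [DecidableEq V]

/-- The single-qubit operator `M` acting on qubit `i` of the register `V`. -/
def onQubit (i : V) (M : Matrix Bool Bool ℂ) : Matrix (V → Bool) (V → Bool) ℂ :=
  Matrix.of fun x y => if ∀ j, j ≠ i → x j = y j then M (x i) (y i) else 0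

/-- The sign of the controlled-`Z` operator on the pair `e` at the basis state `x`. -/
def czSign (e : Sym2 V) (x : V → Bool) : ℂ :=
  open Classical in if ∀ i ∈ e, x i = true then -1 else 1

/-- The controlled-`Z` operator `E_{ij}`. -/
def czOp (i j : V) : Matrix (V → Bool) (V → Bool) ℂ :=
  Matrix.diagonal (czSign s(i, j))

/-! ### Commands -/

/-- The commands of the one-way model; `corrX i j` is the dependent correction `X_i^{s_j}` and
`corrZ i j` is `Z_i^{s_j}`, where `s_j` is the outcome of the measurement of qubit `j`.
The plane and the angle of a measurement are recorded separately. -/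
inductive Command (V : Type*) where
  | prep (i : V)
  | ent (i j : V)
  | meas (i : V)
  | corrX (i j : V)
  | corrZ (i j : V)

/-- The operator of a command on the register `V`, for planes `lam`, angles `α` and outcomes `s`.
A qubit that does not exist (not yet prepared, or destructively measured) is held in the
placeholder state `|0⟩`: preparation is `|+⟩⟨0|`, and a destructive measurement is
`|0⟩⟨±_{λ(i),α_i}|`. -/
def Command.op (lam : V → Plane) (α : V → ℝ) (s : V → Bool) :
    Command V → Matrix (V → Bool) (V → Bool) ℂ
  | .prep i => onQubit i (Matrix.vecMulVec plusState (star ketZero))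
  | .ent i j => czOp i j
  | .meas i => onQubit i (Matrix.vecMulVec ketZero (star (measKet (lam i) (α i) (s i))))
  | .corrX i j => if s j then onQubit i pauliX else 1
  | .corrZ i j => if s j then onQubit i pauliZ else 1

/-- Execution of a sequence of commands, in the order of the list. -/
def runOp (lam : V → Plane) (α : V → ℝ) (s : V → Bool) :
    List (Command V) → Matrix (V → Bool) (V → Bool) ℂ
  | [] => 1
  | c :: cs => runOp lam α s cs * c.op lam α s

/-- The isometry from the space of the qubits in `A` to that of the register, all the other
qubits being held in the placeholder state `|0⟩`. -/
def padZero (A : Finset V) : Matrix (V → Bool) (A → Bool) ℂ :=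
  Matrix.of fun x y => if (∀ i : A, x i = y i) ∧ ∀ i, i ∉ A → x i = false then 1 else 0

/-- `RunnableFrom O live done S`: when the qubits in `live` exist and those in `done` have been
measured, the commands `S` can be executed one after the other (no command depends on an outcome
not yet measured, none acts on a qubit already measured or not yet prepared, apart from the
preparation of a qubit that has not existed so far), and at the end every qubit has been prepared
or was an input, the qubits of `O` exist, and all the others have been measured. -/
def RunnableFrom (O : Finset V) : Finset V → Finset V → List (Command V) → Prop
  | live, done, [] => live = O ∧ done = Oᶜ
  | live, done, .prep i :: cs =>
      i ∉ live ∧ i ∉ done ∧ RunnableFrom O (insert i live) done cs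
  | live, done, .ent i j :: cs =>
      i ∈ live ∧ j ∈ live ∧ i ≠ j ∧ RunnableFrom O live done cs
  | live, done, .meas i :: cs =>
      i ∈ live ∧ RunnableFrom O (live.erase i) (insert i done) cs
  | live, done, .corrX i j :: cs =>
      i ∈ live ∧ j ∈ done ∧ RunnableFrom O live done cs
  | live, done, .corrZ i j :: cs =>
      i ∈ live ∧ j ∈ done ∧ RunnableFrom O live done cs

/-! ### Patterns -/

/-- A measurement pattern `(V, I, O, λ, S)`. The values of `plane` on the outputs are not used.
The measurement angles are left as parameters. -/
structure Pattern (V : Type*) where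
  inputs : Finset V
  outputs : Finset V
  plane : V → Plane
  cmds : List (Command V)

namespace Pattern

variable (P : Pattern V)

/-- The pattern can be run. -/
def Runnable : Prop := RunnableFrom P.outputs P.inputs ∅ P.cmds

/-- The outcome string of a branch: one bit for each measured qubit. -/
abbrev Outcomes : Type _ := {i // i ∉ P.outputs} → Bool

/-- Extension of an outcome string by `0` to the qubits that are not measured. -/
def extend (s : P.Outcomes) (i : V) : Bool := if h : i ∉ P.outputs then s ⟨i, h⟩ else false

/-- The branch map `A_s`, from the space of the inputs to the space of the outputs. -/
def branchMap (α : V → ℝ) (s : P.Outcomes) : Matrix (P.outputs → Bool) (P.inputs → Bool) ℂ :=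
  (padZero P.outputs)ᴴ * runOp P.plane α (P.extend s) P.cmds * padZero P.inputs

/-- The map `T(ρ) = ∑_s A_s ρ A_s†`. -/
def channel (α : V → ℝ) (ρ : Matrix (P.inputs → Bool) (P.inputs → Bool) ℂ) :
    Matrix (P.outputs → Bool) (P.outputs → Bool) ℂ :=
  ∑ s : P.Outcomes, P.branchMap α s * ρ * (P.branchMap α s)ᴴ

/-- The pattern, at angles `α`, realizes the isometry `W`. -/
def Realizes (α : V → ℝ) (W : Matrix (P.outputs → Bool) (P.inputs → Bool) ℂ) : Prop :=
  Wᴴ * W = 1 ∧ ∀ ρ, P.channel α ρ = W * ρ * Wᴴ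

/-- The pattern, at angles `α`, is deterministic: it sends pure states to pure states. -/
def Deterministic (α : V → ℝ) : Prop :=
  ∀ ψ : (P.inputs → Bool) → ℂ, star ψ ⬝ᵥ ψ = 1 →
    ∃ φ : (P.outputs → Bool) → ℂ, star φ ⬝ᵥ φ = 1 ∧
      P.channel α (Matrix.vecMulVec ψ (star ψ)) = Matrix.vecMulVec φ (star φ)

/-- The pattern, at angles `α`, is strongly deterministic: its branch maps are equal up to
global phases. -/
def StronglyDeterministic (α : V → ℝ) : Prop :=
  ∀ s₁ s₂ : P.Outcomes, ∃ θ : ℝ,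
    P.branchMap α s₁ = Complex.exp (Complex.I * θ) • P.branchMap α s₂

/-- The measured qubits, in the order in which the pattern measures them. -/
def measured : List V :=
  P.cmds.filterMap fun c => match c with
    | .meas i => some i
    | _ => none

/-- Whether a command remains when only the qubits of `M` are measured: the other measurements
and the corrections that depend on their outcomes are left out. -/
def keeps (M : Finset V) : Command V → Bool
  | .meas i => decide (i ∈ M)
  | .corrX _ j => decide (j ∈ M)
  | .corrZ _ j => decide (j ∈ M)
  | .prep _ => true
  | .ent _ _ => true

/-- The computation up to and including the `k`-th measurement: only the first `k` measurements
are performed, together with all the corrections that depend on their results. The qubits that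
are not measured are its outputs. -/
def stage (k : ℕ) : Pattern V where
  inputs := P.inputs
  outputs := ((P.measured.take k).toFinset)ᶜ
  plane := P.plane
  cmds := P.cmds.filter (keeps (P.measured.take k).toFinset)

/-- The pattern, at angles `α`, is stepwise deterministic: it is deterministic after each single
measurement together with the corrections depending on its result. -/
def StepwiseDeterministic (α : V → ℝ) : Prop :=
  ∀ k, 1 ≤ k → k ≤ P.measured.length → (P.stage k).Deterministic α

/-- The angles of all the measurements lie in `[0, π]`. -/
def AdmissibleAngles (α : V → ℝ) : Prop :=
  ∀ i, i ∉ P.outputs → α i ∈ Set.Icc 0 Real.pi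

/-- For all values of the measurement angles, the pattern is deterministic, strongly
deterministic and stepwise deterministic. -/
def UniformlyStronglyStepwiseDeterministic : Prop :=
  ∀ α, P.AdmissibleAngles α →
    P.Deterministic α ∧ P.StronglyDeterministic α ∧ P.StepwiseDeterministic α

/-- Whether a command is the entangling operator of the pair `{i, j}`. -/
def isEnt (i j : V) : Command V → Bool
  | .ent a b => decide ((a = i ∧ b = j) ∨ (a = j ∧ b = i))
  | _ => false

/-- The entanglement graph of the pattern. As `E_{ij}² = 1`, two entangling commands on the same
pair cancel, so `i ∼ j` if and only if the number of commands `E_{ij}` is odd. -/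
def graph : SimpleGraph V where
  Adj i j := i ≠ j ∧ Odd (P.cmds.countP (isEnt i j))
  symm := ⟨by
    rintro i j ⟨hne, hodd⟩
    refine ⟨hne.symm, ?_⟩
    have h : (isEnt j i : Command V → Bool) = isEnt i j := by
      funext c
      cases c <;> simp [isEnt, or_comm]
    rwa [h]⟩
  loopless := ⟨fun _ h => h.1 rfl⟩

end Pattern

/-! ### Open graph states -/

/-- The odd neighbourhood of `K`: the vertices with an odd number of neighbours in `K`. -/
def oddNbhd (G : SimpleGraph V) (K : Finset V) : Set V :=
  {u | Odd (G.neighborSet u ∩ (K : Set V)).ncard}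

/-- `(g, <)` is a generalized flow of the open graph state `(G, I, O, lam)`. -/
structure IsGFlow (G : SimpleGraph V) (I O : Finset V) (lam : V → Plane)
    (g : {i // i ∉ O} → Finset V) (ord : PartialOrder V) : Prop where
  prepared : ∀ i, ∀ j ∈ g i, j ∉ I
  future : ∀ i, ∀ j ∈ g i, i.1 ≠ j → ord.lt i.1 j
  past : ∀ i, ∀ j, ord.le j i.1 → i.1 ≠ j → j ∉ oddNbhd G (g i)
  planeXY : ∀ i, lam i.1 = .XY → i.1 ∉ g i ∧ i.1 ∈ oddNbhd G (g i)
  planeXZ : ∀ i, lam i.1 = .XZ → i.1 ∈ g i ∧ i.1 ∈ oddNbhd G (g i)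
  planeYZ : ∀ i, lam i.1 = .YZ → i.1 ∈ g i ∧ i.1 ∉ oddNbhd G (g i)

/-- The open graph state `(G, I, O, lam)` has a generalized flow. -/
def HasGFlow (G : SimpleGraph V) (I O : Finset V) (lam : V → Plane) : Prop :=
  ∃ (g : {i // i ∉ O} → Finset V) (ord : PartialOrder V), IsGFlow G I O lam g ord

/-- The preparation `N_{I^c}`, from the space of `I` to the space of `V`: it sends `ψ` to the
tensor product of `ψ` with `|+⟩` on every qubit outside `I`. -/
def prepMap (I : Finset V) : Matrix (V → Bool) (I → Bool) ℂ :=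
  Matrix.of fun x y => if ∀ i : I, x i = y i then ∏ i ∈ Iᶜ, plusState (x i) else 0

/-- The global entanglement operator `E_G`, the product of the (diagonal, hence commuting)
controlled-`Z` operators over the edges of `G`. -/
def entMap (G : SimpleGraph V) : Matrix (V → Bool) (V → Bool) ℂ :=
  open Classical in Matrix.diagonal fun x => ∏ e ∈ G.edgeFinset, czSign e x

/-- The product of the `⟨+_{λ(i),α_i}|` over the qubits outside `O`, from the space of `V` to
the space of `O`. -/
def postselectMap (O : Finset V) (lam : V → Plane) (α : V → ℝ) :
    Matrix (O → Bool) (V → Bool) ℂ :=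
  Matrix.of fun y x =>
    if ∀ i : O, x i = y i then ∏ i ∈ Oᶜ, star (measKet (lam i) (α i) false (x i)) else 0

/-- The map `U_G = (∏_{i ∈ O^c} ⟨+_{λ(i),α_i}|_i) E_G N_{I^c}`. -/
def graphEmbedding (G : SimpleGraph V) (I O : Finset V) (lam : V → Plane) (α : V → ℝ) :
    Matrix (O → Bool) (I → Bool) ℂ :=
  postselectMap O lam α * entMap G * prepMap I

end Register

end MBQC

end

/-! Nothing acts on a measured qubit, and a qubit not yet prepared may be treated as already in a
uniform state. A branch map applied to `ψ` is therefore obtained by preparing everything, running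
the entanglers and corrections on the whole register, and contracting the measured qubits with their
bras at the end (`branchMap_mulVec`). In the all-zero branch no correction fires, so its map is
exactly `U_G` (`branchMap_false_eq`). Strong determinism carries this to every branch up to phases;
the branch norms then sum to one, which makes the rescaled `U_G` an isometry (`realizes`).

For the flow, stop the pattern at the measurement of `i` and take the branch whose only outcome 1 is
at `i`. The corrections that fire, moved past the entanglers, form a Pauli operator on qubits not
yet measured (`unitaryRun_eq_pauli`). The bra of outcome 1 is the bra of outcome 0 composed with a
Pauli on `i` that depends on the plane and not on the angle (`exists_planeBra_true`). Stepwise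
determinism makes this branch parallel to the zero branch, so the product of the two Paulis
preserves the contracted graph state up to a scalar, at all angles.

Comparing the angles `0`, `π / 2`, `π` removes the contractions one qubit at a time: the product has
the graph state itself as an eigenvector, for every input (`eigen_of_contractList`,
`exists_correction`). Such a Pauli `Z_L X_K` must flip no input and have `L = Odd(K)`
(`stabilizer_of_eigen`). Setting `g(i) = K` and ordering qubits by measurement time gives the flow
(`hasGFlow`). -/

noncomputable section

set_option linter.unusedSectionVars false

namespace MBQC

/-! ### Contracting qubits of a register vector with bras. -/

section Contraction

variable {V : Type*} [DecidableEq V]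

/-- Contraction of qubit `i` of `w` with the bra whose coefficients are `m`; the result does not
depend on the coordinate `i`. -/
def contract (i : V) (m : Bool → ℂ) (w : (V → Bool) → ℂ) : (V → Bool) → ℂ := fun x =>
  m false * w (Function.update x i false) + m true * w (Function.update x i true)

/-- Contraction of the qubits of a list. -/
def contractList (μ : V → Bool → ℂ) : List V → ((V → Bool) → ℂ) → (V → Bool) → ℂ
  | [], w => w
  | i :: L, w => contractList μ L (contract i (μ i) w)

/-- The bra of the outcome `s i` of the measurement of qubit `i`. -/
def bra (lam : V → Plane) (α : V → ℝ) (s : V → Bool) (i : V) (b : Bool) : ℂ :=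
  star (measKet (lam i) (α i) (s i) b)

/-- `w` does not depend on coordinate `i`. -/
def IndepOf (i : V) (w : (V → Bool) → ℂ) : Prop :=
  ∀ x b, w (Function.update x i b) = w x

theorem contract_add (i : V) (m : Bool → ℂ) (v w : (V → Bool) → ℂ) :
    contract i m (v + w) = contract i m v + contract i m w := by
  funext x; simp only [contract, Pi.add_apply]; ring

theorem contract_smul (i : V) (m : Bool → ℂ) (c : ℂ) (w : (V → Bool) → ℂ) :
    contract i m (c • w) = c • contract i m w := by
  funext x; simp only [contract, Pi.smul_apply, smul_eq_mul]; ring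

theorem contract_add_bra (i : V) (m m' : Bool → ℂ) (w : (V → Bool) → ℂ) (p q : ℂ) :
    contract i (p • m + q • m') w = p • contract i m w + q • contract i m' w := by
  funext x; simp only [contract, Pi.smul_apply, Pi.add_apply, smul_eq_mul]; ring

theorem contractList_add (μ : V → Bool → ℂ) (L : List V) (v w : (V → Bool) → ℂ) :
    contractList μ L (v + w) = contractList μ L v + contractList μ L w := by
  induction L generalizing v w with
  | nil => rfl
  | cons i L ih => simp only [contractList, contract_add, ih]

theorem contractList_smul (μ : V → Bool → ℂ) (L : List V) (c : ℂ) (w : (V → Bool) → ℂ) :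
    contractList μ L (c • w) = c • contractList μ L w := by
  induction L generalizing w with
  | nil => rfl
  | cons i L ih => simp only [contractList, contract_smul, ih]

theorem contractList_append (μ : V → Bool → ℂ) (L L' : List V) (w : (V → Bool) → ℂ) :
    contractList μ (L ++ L') w = contractList μ L' (contractList μ L w) := by
  induction L generalizing w with
  | nil => rfl
  | cons i L ih => simp only [List.cons_append, contractList, ih]

theorem contractList_congr {μ ν : V → Bool → ℂ} {L : List V} (h : ∀ i ∈ L, μ i = ν i)
    (w : (V → Bool) → ℂ) : contractList μ L w = contractList ν L w := by
  induction L generalizing w with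
  | nil => rfl
  | cons i L ih =>
    simp only [contractList, h i (by simp)]
    exact ih (fun j hj => h j (by simp [hj])) _

theorem IndepOf.contract {i j : V} {w : (V → Bool) → ℂ} (h : IndepOf i w) (m : Bool → ℂ) :
    IndepOf i (contract j m w) := by
  intro x b
  by_cases hij : i = j
  · subst hij; simp [MBQC.contract]
  · simp only [MBQC.contract, Function.update_comm hij, h _ b]

theorem indepOf_contract (i : V) (m : Bool → ℂ) (w : (V → Bool) → ℂ) :
    IndepOf i (contract i m w) := by
  intro x b; simp [contract]

end Contraction

/-! ### Executing a pattern with preparations moved to the start and measurements to the end. -/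

section Run

variable {V : Type*} [Fintype V] [DecidableEq V]

/-- A command with its preparations and measurements left out, on the full register. -/
def unitaryStep (s : V → Bool) : Command V → ((V → Bool) → ℂ) → (V → Bool) → ℂ
  | .prep _, w => w
  | .meas _, w => w
  | .ent i j, w => fun x => czSign s(i, j) x * w x
  | .corrX i j, w => if s j then fun x => w (Function.update x i (!x i)) else w
  | .corrZ i j, w => if s j then fun x => (if x i then -1 else 1) * w x else w

/-- The entangling operators and the corrections of a sequence of commands, executed on the full
register. -/
def unitaryRun (s : V → Bool) : List (Command V) → ((V → Bool) → ℂ) → (V → Bool) → ℂ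
  | [], w => w
  | c :: cs, w => unitaryRun s cs (unitaryStep s c w)

/-- The measured qubits of a sequence of commands, in order. -/
def measuredIn (cs : List (Command V)) : List V :=
  cs.filterMap fun c => match c with
    | .meas i => some i
    | _ => none

theorem czSign_mk (i j : V) (x : V → Bool) :
    czSign s(i, j) x = if x i && x j then -1 else 1 := by
  unfold czSign
  simp [Sym2.mem_iff]

theorem onQubit_mulVec (i : V) (M : Matrix Bool Bool ℂ) (v : (V → Bool) → ℂ) (x : V → Bool) :
    (onQubit i M *ᵥ v) x = M (x i) false * v (Function.update x i false) +
      M (x i) true * v (Function.update x i true) := by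
  have hne : Function.update x i false ≠ Function.update x i true := fun h => by
    simpa using congrFun h i
  rw [Matrix.mulVec, dotProduct, ← Finset.sum_subset
    (Finset.subset_univ {Function.update x i false, Function.update x i true})]
  · rw [Finset.sum_pair hne]
    simp only [onQubit, Matrix.of_apply]
    rw [if_pos, if_pos]
    · simp
    · intro j hj; simp [hj]
    · intro j hj; simp [hj]
  · intro y _ hy
    simp only [onQubit, Matrix.of_apply]
    rw [if_neg, zero_mul]
    intro h
    apply hy
    have : y = Function.update x i (y i) := by
      funext j
      by_cases hj : j = i
      · subst hj; simp
      · simp [hj, h j hj]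
    rw [this]
    cases y i <;> simp

theorem plusState_eq (b : Bool) : plusState b = ((Real.sqrt 2 : ℝ) : ℂ)⁻¹ := by
  have h : Real.pi / 2 / 2 = Real.pi / 4 := by ring
  have h2 : (Real.sqrt 2 / 2 : ℝ) = (Real.sqrt 2)⁻¹ := by
    rw [div_eq_iff two_ne_zero, eq_comm, inv_mul_eq_iff_eq_mul₀ (by positivity)]
    simp
  cases b <;>
    simp only [plusState, ketPlus, h, Real.cos_pi_div_four, Real.sin_pi_div_four, h2] <;> simp

theorem indepOf_unitaryStep {s : V → Bool} {j : V} {w : (V → Bool) → ℂ} (h : IndepOf j w)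
    (c : Command V) (hc : match c with
      | .ent a b => j ≠ a ∧ j ≠ b
      | .corrX a _ => j ≠ a
      | .corrZ a _ => j ≠ a
      | _ => True) : IndepOf j (unitaryStep s c w) := by
  intro x b
  cases c with
  | prep i => exact h x b
  | meas i => exact h x b
  | ent i k =>
    simp only [unitaryStep, czSign_mk, Function.update_of_ne hc.1.symm,
      Function.update_of_ne hc.2.symm, h x b]
  | corrX i k =>
    have hc' : j ≠ i := hc
    simp only [unitaryStep]
    split_ifs
    · simp only [Function.update_of_ne hc'.symm, Function.update_comm hc', h _ b]
    · exact h x b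
  | corrZ i k =>
    have hc' : j ≠ i := hc
    simp only [unitaryStep]
    split_ifs <;> simp [Function.update_of_ne hc'.symm, h x b]

theorem unitaryStep_contract {s : V → Bool} {j : V} (m : Bool → ℂ) (w : (V → Bool) → ℂ)
    (c : Command V) (hc : match c with
      | .ent a b => j ≠ a ∧ j ≠ b
      | .corrX a _ => j ≠ a
      | .corrZ a _ => j ≠ a
      | _ => True) :
    unitaryStep s c (contract j m w) = contract j m (unitaryStep s c w) := by
  cases c with
  | prep i => rfl
  | meas i => rfl
  | ent i k =>
    funext x
    simp only [unitaryStep, contract, czSign_mk, Function.update_of_ne hc.1.symm,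
      Function.update_of_ne hc.2.symm]
    ring
  | corrX i k =>
    have hc' : j ≠ i := hc
    funext x
    simp only [unitaryStep]
    split_ifs
    · simp only [contract, Function.update_of_ne hc'.symm, Function.update_comm hc']
    · rfl
  | corrZ i k =>
    have hc' : j ≠ i := hc
    funext x
    simp only [unitaryStep]
    split_ifs with hs
    · simp only [contract, Function.update_of_ne hc'.symm]
      ring
    · rfl

theorem ne_of_mem_live {live done : Finset V} (hd : Disjoint live done) {i j : V} (hi : i ∈ live)
    (hj : j ∈ done) : j ≠ i := fun h => Finset.disjoint_left.1 hd hi (h ▸ hj)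

theorem disjoint_insert_live {live done : Finset V} (hd : Disjoint live done) {i : V}
    (hi : i ∉ done) : Disjoint (insert i live) done := by
  rw [Finset.disjoint_insert_left]; exact ⟨hi, hd⟩

theorem disjoint_measure {live done : Finset V} (hd : Disjoint live done) (i : V) :
    Disjoint (live.erase i) (insert i done) := by
  rw [Finset.disjoint_insert_right]
  exact ⟨by simp, hd.mono_left (Finset.erase_subset _ _)⟩

/-- Runnability forbids any later command from touching a measured qubit; this is what allows
measurements to be postponed to the end. -/
theorem unitaryRun_contract {O : Finset V} {s : V → Bool} (cs : List (Command V))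
    {live done : Finset V} (hd : Disjoint live done) (hr : RunnableFrom O live done cs) {j : V}
    (hj : j ∈ done) (m : Bool → ℂ) (w : (V → Bool) → ℂ) :
    unitaryRun s cs (contract j m w) = contract j m (unitaryRun s cs w) := by
  induction cs generalizing live done w with
  | nil => rfl
  | cons c cs ih =>
    rw [unitaryRun, unitaryStep_contract]
    · cases c with
      | prep i => exact ih (disjoint_insert_live hd hr.2.1) hr.2.2 hj _
      | meas i => exact ih (disjoint_measure hd i) hr.2 (Finset.mem_insert_of_mem hj) _
      | ent i k => exact ih hd hr.2.2.2 hj _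
      | corrX i k => exact ih hd hr.2.2 hj _
      | corrZ i k => exact ih hd hr.2.2 hj _
    · cases c with
      | prep i => trivial
      | meas i => trivial
      | ent i k => exact ⟨ne_of_mem_live hd hr.1 hj, ne_of_mem_live hd hr.2.1 hj⟩
      | corrX i k => exact ne_of_mem_live hd hr.1 hj
      | corrZ i k => exact ne_of_mem_live hd hr.1 hj

/-- The vector of the register whose qubits in `live` are in the state `w`, the others being held
in the placeholder state. -/
def placeholder (live : Finset V) (w : (V → Bool) → ℂ) : (V → Bool) → ℂ :=
  fun x => if ∀ j, j ∉ live → x j = false then w x else 0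

theorem unitaryStep_placeholder {live : Finset V} (lam : V → Plane) (α : V → ℝ) (s : V → Bool)
    (w : (V → Bool) → ℂ) (c : Command V) (hc : match c with
      | .ent a b => a ∈ live ∧ b ∈ live
      | .corrX a _ => a ∈ live
      | .corrZ a _ => a ∈ live
      | _ => False) :
    c.op lam α s *ᵥ placeholder live w = placeholder live (unitaryStep s c w) := by
  cases c with
  | prep i => exact hc.elim
  | meas i => exact hc.elim
  | ent i k =>
    funext x
    simp only [Command.op, czOp, Matrix.mulVec_diagonal, placeholder, unitaryStep]
    split_ifs <;> simp
  | corrX i k =>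
    have hc' : i ∈ live := hc
    funext x
    simp only [Command.op, unitaryStep]
    split_ifs
    · rw [onQubit_mulVec]
      have key : ∀ b, (∀ j, j ∉ live → Function.update x i b j = false) ↔
          ∀ j, j ∉ live → x j = false := fun b => by
        refine forall_congr' fun j => forall_congr' fun hj => ?_
        rw [Function.update_of_ne (by rintro rfl; exact hj hc')]
      simp only [placeholder, key]
      cases h : x i <;> simp [pauliX]
    · simp
  | corrZ i k =>
    funext x
    simp only [Command.op, unitaryStep]
    split_ifs
    · rw [onQubit_mulVec]
      have hx : ∀ b, x i = b → Function.update x i b = x := fun b h => by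
        rw [← h, Function.update_eq_self]
      cases h : x i <;> simp [pauliZ, hx _ h, placeholder, h]
    · simp

theorem prep_placeholder {live : Finset V} {i : V} (hi : i ∉ live) {w : (V → Bool) → ℂ}
    (hw : IndepOf i w) :
    onQubit i (Matrix.vecMulVec plusState (star ketZero)) *ᵥ placeholder live w =
      placeholder (insert i live) (((Real.sqrt 2 : ℝ) : ℂ)⁻¹ • w) := by
  funext x
  rw [onQubit_mulVec]
  have key : (∀ j, j ∉ live → Function.update x i false j = false) ↔
      ∀ j, j ∉ insert i live → x j = false := by
    refine forall_congr' fun j => ?_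
    by_cases hj : j = i
    · subst hj; simp
    · simp [hj]
  simp [Matrix.vecMulVec_apply, ketZero, placeholder, key, plusState_eq, hw x false]

theorem meas_placeholder {live : Finset V} {i : V} (hi : i ∈ live) (m : Bool → ℂ)
    (w : (V → Bool) → ℂ) :
    onQubit i (Matrix.vecMulVec ketZero (star m)) *ᵥ placeholder live w =
      placeholder (live.erase i) (contract i (star m) w) := by
  funext x
  rw [onQubit_mulVec]
  have key : ∀ b, x i = false → ((∀ j, j ∉ live → Function.update x i b j = false) ↔
      ∀ j, j ∉ live.erase i → x j = false) := fun b hx => by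
    refine forall_congr' fun j => ?_
    by_cases hj : j = i
    · subst hj; simp [hi, hx]
    · simp [hj]
  cases hx : x i with
  | true =>
    have : ¬ ∀ j, j ∉ live.erase i → x j = false := fun h => by
      simpa [hx] using h i (by simp)
    simp only [Matrix.vecMulVec_apply, ketZero, placeholder, if_neg this]
    simp
  | false =>
    simp only [Matrix.vecMulVec_apply, ketZero, placeholder, key _ hx, contract]
    split_ifs <;> simp

/-- Here `w` already contains the pending qubits, uniformly, since it does not depend on them. A
preparation then only enlarges the support of the placeholder vector and multiplies by `1/√2`; the
power of `√2` counts the preparations still to come. -/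
theorem runOp_placeholder {O : Finset V} (lam : V → Plane) (α : V → ℝ) (s : V → Bool)
    (cs : List (Command V)) {live done : Finset V} (hd : Disjoint live done)
    (hr : RunnableFrom O live done cs) (w : (V → Bool) → ℂ) (hw : ∀ j, j ∉ live → IndepOf j w) :
    runOp lam α s cs *ᵥ
        placeholder live (((Real.sqrt 2 : ℝ) : ℂ) ^ ((live ∪ done)ᶜ.card) • w) =
      placeholder O (contractList (bra lam α s) (measuredIn cs) (unitaryRun s cs w)) := by
  induction cs generalizing live done w with
  | nil =>
    obtain ⟨rfl, rfl⟩ := hr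
    simp [runOp, measuredIn, contractList, unitaryRun]
  | cons c cs ih =>
    rw [runOp, ← Matrix.mulVec_mulVec]
    cases c with
    | prep i =>
      obtain ⟨h1, h2, hr⟩ := hr
      have hw' : IndepOf i (((Real.sqrt 2 : ℝ) : ℂ) ^ ((live ∪ done)ᶜ.card) • w) := fun x b => by
        simp [hw i h1 x b]
      rw [Command.op, prep_placeholder h1 hw']
      have hcard : (live ∪ done)ᶜ.card = (insert i live ∪ done)ᶜ.card + 1 := by
        rw [Finset.insert_union, Finset.compl_insert, Finset.card_erase_of_mem (by simp [h1, h2])]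
        have : 0 < (live ∪ done)ᶜ.card := Finset.card_pos.2 ⟨i, by simp [h1, h2]⟩
        omega
      have h2' : ((Real.sqrt 2 : ℝ) : ℂ) ≠ 0 := by
        simp
      rw [hcard, pow_succ, smul_smul, mul_comm, mul_assoc, mul_inv_cancel₀ h2', mul_one]
      exact ih (disjoint_insert_live hd h2) hr w fun j hj => hw j fun h => hj (by simp [h])
    | meas i =>
      obtain ⟨h1, hr⟩ := hr
      -- A measurement leaves the number of pending preparations unchanged, so the power of `√2` is
      -- the same before and after.
      have hu : live ∪ done = live.erase i ∪ insert i done := by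
        ext j; by_cases hj : j = i <;> simp [hj, h1]
      have e1 : measuredIn (Command.meas i :: cs) = i :: measuredIn cs := rfl
      rw [Command.op, meas_placeholder h1, contract_smul, hu, ih (disjoint_measure hd i) hr, e1,
        unitaryRun_contract cs (disjoint_measure hd i) hr (Finset.mem_insert_self _ _)]
      · rfl
      · intro j hj
        by_cases hji : j = i
        · subst hji; exact indepOf_contract _ _ _
        · exact (hw j fun h => hj (by simp [h, hji])).contract _
    | ent i k =>
      obtain ⟨h1, h2, -, hr⟩ := hr
      rw [unitaryStep_placeholder lam α s _ (.ent i k) ⟨h1, h2⟩]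
      have e : unitaryStep s (Command.ent i k) (((Real.sqrt 2 : ℝ) : ℂ) ^ ((live ∪ done)ᶜ.card) • w)
          = ((Real.sqrt 2 : ℝ) : ℂ) ^ ((live ∪ done)ᶜ.card) •
            unitaryStep s (Command.ent i k) w := by
        funext x; simp [unitaryStep]; ring
      rw [e]
      refine ih hd hr _ fun j hj => indepOf_unitaryStep (hw j hj) _ ⟨?_, ?_⟩
      · rintro rfl; exact hj h1
      · rintro rfl; exact hj h2
    | corrX i k =>
      obtain ⟨h1, h2, hr⟩ := hr
      rw [unitaryStep_placeholder lam α s _ (.corrX i k) h1]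
      have e : unitaryStep s (Command.corrX i k)
          (((Real.sqrt 2 : ℝ) : ℂ) ^ ((live ∪ done)ᶜ.card) • w)
          = ((Real.sqrt 2 : ℝ) : ℂ) ^ ((live ∪ done)ᶜ.card) •
            unitaryStep s (Command.corrX i k) w := by
        funext x; simp only [unitaryStep]; split_ifs <;> simp
      rw [e]
      refine ih hd hr _ fun j hj => indepOf_unitaryStep (hw j hj) _ ?_
      rintro rfl; exact hj h1
    | corrZ i k =>
      obtain ⟨h1, h2, hr⟩ := hr
      rw [unitaryStep_placeholder lam α s _ (.corrZ i k) h1]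
      have e : unitaryStep s (Command.corrZ i k)
          (((Real.sqrt 2 : ℝ) : ℂ) ^ ((live ∪ done)ᶜ.card) • w)
          = ((Real.sqrt 2 : ℝ) : ℂ) ^ ((live ∪ done)ᶜ.card) •
            unitaryStep s (Command.corrZ i k) w := by
        funext x; simp only [unitaryStep]; split_ifs <;> simp
      rw [e]
      refine ih hd hr _ fun j hj => indepOf_unitaryStep (hw j hj) _ ?_
      rintro rfl; exact hj h1

end Run

/-! ### Contraction of a list of qubits as an explicit sum. -/

section Contraction

variable {V : Type*} [DecidableEq V]

theorem IndepOf.contractList {i : V} {w : (V → Bool) → ℂ} (h : IndepOf i w) (μ : V → Bool → ℂ)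
    (L : List V) : IndepOf i (contractList μ L w) := by
  induction L generalizing w with
  | nil => exact h
  | cons j L ih => exact ih (h.contract _)

theorem indepOf_contractList {i : V} (μ : V → Bool → ℂ) {L : List V} (hi : i ∈ L)
    (w : (V → Bool) → ℂ) : IndepOf i (contractList μ L w) := by
  induction L generalizing w with
  | nil => simp at hi
  | cons j L ih =>
    rcases List.mem_cons.1 hi with rfl | hi
    · exact (indepOf_contract _ _ _).contractList μ L
    · exact ih hi _

theorem apply_eq_of_indepOf [Fintype V] {O : Finset V} {w : (V → Bool) → ℂ}
    (hw : ∀ j, j ∉ O → IndepOf j w) {x y : V → Bool} (h : ∀ i ∈ O, x i = y i) : w x = w y := by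
  have key : ∀ S : Finset V, (∀ j ∈ S, IndepOf j w) →
      w (fun i => if i ∈ S then y i else x i) = w x := by
    intro S
    induction S using Finset.induction_on with
    | empty => intro _; simp
    | insert a S ha ih =>
      intro hS
      rw [← ih fun j hj => hS j (Finset.mem_insert_of_mem hj),
        ← hS a (Finset.mem_insert_self _ _) (fun i => if i ∈ S then y i else x i) (y a)]
      congr 1
      funext i
      by_cases hi : i = a
      · subst hi; simp
      · simp [hi]
  rw [← key Oᶜ fun j hj => hw j (Finset.mem_compl.1 hj)]
  congr 1
  funext i
  by_cases hi : i ∈ O <;> simp [hi, h]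

/-- Indicator of the strings that agree with `x₀` outside `T`. -/
def agreeOff (T : Finset V) (x₀ : V → Bool) : (V → Bool) → ℂ :=
  open Classical in fun x => if ∀ j, j ∉ T → x j = x₀ j then 1 else 0

theorem contract_agreeOff {T : Finset V} {i : V} (hi : i ∉ T) (m : Bool → ℂ) (x₀ : V → Bool) :
    contract i m (agreeOff T x₀) = m (x₀ i) • agreeOff (insert i T) x₀ := by
  funext x
  have key : ∀ b, (∀ j, j ∉ T → Function.update x i b j = x₀ j) ↔
      b = x₀ i ∧ ∀ j, j ∉ insert i T → x j = x₀ j := by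
    intro b
    constructor
    · intro h
      refine ⟨by simpa using h i hi, fun j hj => ?_⟩
      simp only [Finset.mem_insert, not_or] at hj
      simpa [hj.1] using h j hj.2
    · rintro ⟨h1, h2⟩ j hj
      by_cases hji : j = i
      · subst hji; simpa using h1
      · simpa [hji] using h2 j (by simp [hji, hj])
  have val : ∀ b, agreeOff T x₀ (Function.update x i b) =
      if b = x₀ i then agreeOff (insert i T) x₀ x else 0 := by
    intro b
    unfold agreeOff
    by_cases h : b = x₀ i ∧ ∀ j, j ∉ insert i T → x j = x₀ j
    · rw [if_pos ((key b).2 h), if_pos h.1, if_pos h.2]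
    · rw [if_neg (mt (key b).1 h)]
      by_cases hb : b = x₀ i
      · rw [if_pos hb, if_neg fun h' => h ⟨hb, h'⟩]
      · rw [if_neg hb]
  rw [contract, val, val]
  cases x₀ i <;> simp

theorem contractList_agreeOff (μ : V → Bool → ℂ) {L : List V} (hL : L.Nodup) {T : Finset V}
    (hT : ∀ i ∈ L, i ∉ T) (x₀ : V → Bool) :
    contractList μ L (agreeOff T x₀) =
      (∏ i ∈ L.toFinset, μ i (x₀ i)) • agreeOff (T ∪ L.toFinset) x₀ := by
  induction L generalizing T with
  | nil => simp [contractList]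
  | cons i L ih =>
    have h := List.nodup_cons.1 hL
    have hT' : ∀ j ∈ L, j ∉ insert i T := by
      intro j hj hj'
      rcases Finset.mem_insert.1 hj' with rfl | hj'
      · exact h.1 hj
      · exact hT j (by simp [hj]) hj'
    rw [contractList, contract_agreeOff (hT i (by simp)), contractList_smul, ih h.2 hT', smul_smul,
      List.toFinset_cons, Finset.prod_insert (by simpa using h.1)]
    congr 2
    ext j; simp only [Finset.mem_union, Finset.mem_insert]; tauto

theorem contractList_sum {ι : Type*} (μ : V → Bool → ℂ) (L : List V) (S : Finset ι)
    (f : ι → (V → Bool) → ℂ) :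
    contractList μ L (∑ a ∈ S, f a) = ∑ a ∈ S, contractList μ L (f a) := by
  classical
  induction S using Finset.induction_on with
  | empty => simpa using contractList_smul μ L 0 0
  | insert a S ha ih => rw [Finset.sum_insert ha, Finset.sum_insert ha, contractList_add, ih]

/-- By linearity it suffices to contract basis vectors `agreeOff ∅ x₀`; each contraction extracts
one coefficient and frees one coordinate. -/
theorem contractList_apply [Fintype V] (μ : V → Bool → ℂ) {L : List V} (hL : L.Nodup)
    (w : (V → Bool) → ℂ) (x : V → Bool) :
    contractList μ L w x =
      ∑ x₀, (∏ i ∈ L.toFinset, μ i (x₀ i)) * agreeOff L.toFinset x₀ x * w x₀ := by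
  have hw : w = ∑ x₀, w x₀ • agreeOff ∅ x₀ := by
    funext x
    rw [Finset.sum_apply, Finset.sum_eq_single x]
    · simp [agreeOff]
    · intro y _ hy
      simp only [agreeOff, Pi.smul_apply, smul_eq_mul]
      rw [if_neg, mul_zero]
      intro h
      exact hy (funext fun j => (h j (by simp)).symm)
    · simp
  conv_lhs => rw [hw]
  rw [contractList_sum, Finset.sum_apply]
  refine Finset.sum_congr rfl fun x₀ _ => ?_
  rw [contractList_smul, contractList_agreeOff μ hL (by simp)]
  simp only [Pi.smul_apply, smul_eq_mul, Finset.empty_union]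
  ring

end Contraction

/-! ### Branch maps and `U_G` as contractions of a graph state. -/

section Pattern

variable {V : Type*} [Fintype V] [DecidableEq V]

theorem measuredIn_of_runnable {O : Finset V} (cs : List (Command V)) {live done : Finset V}
    (hd : Disjoint live done) (hr : RunnableFrom O live done cs) :
    (measuredIn cs).Nodup ∧ (∀ j ∈ done, j ∉ O) ∧ ∀ j, j ∈ measuredIn cs ↔ j ∉ O ∧ j ∉ done := by
  induction cs generalizing live done with
  | nil =>
    obtain ⟨rfl, rfl⟩ := hr
    simp [measuredIn]
  | cons c cs ih =>
    cases c with
    | prep i => exact ih (disjoint_insert_live hd hr.2.1) hr.2.2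
    | meas i =>
      obtain ⟨h1, h2, h3⟩ := ih (disjoint_measure hd i) hr.2
      have e : measuredIn (Command.meas i :: cs) = i :: measuredIn cs := rfl
      have hi : i ∉ done := Finset.disjoint_left.1 hd hr.1
      refine ⟨?_, fun j hj => h2 j (by simp [hj]), fun j => ?_⟩
      · rw [e, List.nodup_cons]
        exact ⟨by simp [h3], h1⟩
      · rw [e, List.mem_cons, h3]
        by_cases hji : j = i
        · subst hji; simp [hi, h2 j (by simp)]
        · simp [hji]
    | ent i k => exact ih hd hr.2.2.2
    | corrX i k => exact ih hd hr.2.2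
    | corrZ i k => exact ih hd hr.2.2

/-- The pairs of the entangling operators of a sequence of commands. -/
def entPairs (cs : List (Command V)) : List (Sym2 V) :=
  cs.filterMap fun c => match c with
    | .ent i j => some s(i, j)
    | _ => none

/-- The sign by which the entangling operators of a sequence of commands act. -/
def entSign (cs : List (Command V)) (x : V → Bool) : ℂ :=
  ((entPairs cs).map fun e => czSign e x).prod

theorem entSign_cons_ent (i j : V) (cs : List (Command V)) (x : V → Bool) :
    entSign (.ent i j :: cs) x = czSign s(i, j) x * entSign cs x := by
  simp [entSign, entPairs]

theorem unitaryRun_false (cs : List (Command V)) (w : (V → Bool) → ℂ) :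
    unitaryRun (fun _ => false) cs w = fun x => entSign cs x * w x := by
  induction cs generalizing w with
  | nil => simp [unitaryRun, entSign, entPairs]
  | cons c cs ih =>
    rw [unitaryRun, ih]
    funext x
    cases c with
    | ent i j => rw [entSign_cons_ent]; simp only [unitaryStep]; ring
    | prep i => rfl
    | meas i => rfl
    | corrX i j => rfl
    | corrZ i j => rfl

theorem czSign_mul_self (e : Sym2 V) (x : V → Bool) : czSign e x * czSign e x = 1 := by
  unfold czSign; split_ifs <;> simp

theorem czSign_pow (e : Sym2 V) (x : V → Bool) (n : ℕ) :
    czSign e x ^ n = if Odd n then czSign e x else 1 := by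
  rcases Nat.even_or_odd' n with ⟨k, rfl | rfl⟩
  · rw [if_neg (by simp), pow_mul, pow_two, czSign_mul_self, one_pow]
  · rw [if_pos (by simp), pow_succ, pow_mul, pow_two, czSign_mul_self, one_pow, one_mul]

theorem countP_isEnt (cs : List (Command V)) (i j : V) :
    cs.countP (Pattern.isEnt i j) = (entPairs cs).count s(i, j) := by
  induction cs with
  | nil => rfl
  | cons c cs ih =>
    rw [List.countP_cons, ih]
    cases c with
    | ent a b =>
      have e : entPairs (Command.ent a b :: cs) = s(a, b) :: entPairs cs := rfl
      rw [e, List.count_cons]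
      simp [Pattern.isEnt]
    | prep i => rfl
    | meas i => rfl
    | corrX i j => rfl
    | corrZ i j => rfl

theorem not_isDiag_of_runnable {O : Finset V} (cs : List (Command V)) {live done : Finset V}
    (hr : RunnableFrom O live done cs) : ∀ e ∈ entPairs cs, ¬ e.IsDiag := by
  induction cs generalizing live done with
  | nil => simp [entPairs]
  | cons c cs ih =>
    cases c with
    | prep i => exact ih hr.2.2
    | meas i => exact ih hr.2
    | ent i k =>
      have e : entPairs (Command.ent i k :: cs) = s(i, k) :: entPairs cs := rfl
      rw [e]
      simpa [hr.2.2.1] using ih hr.2.2.2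
    | corrX i k => exact ih hr.2.2
    | corrZ i k => exact ih hr.2.2

/-- The sign by which the operator `E_G` acts. -/
def graphSign (G : SimpleGraph V) (x : V → Bool) : ℂ :=
  open Classical in ∏ e ∈ G.edgeFinset, czSign e x

/-- Each sign squares to one, so only the parity of the multiplicity of a pair matters, and
runnability excludes loops. -/
theorem entSign_eq_graphSign (P : Pattern V) (hP : P.Runnable) :
    entSign P.cmds = graphSign P.graph := by
  classical
  funext x
  rw [entSign, Finset.prod_list_map_count, graphSign]
  simp only [czSign_pow]
  rw [← Finset.prod_filter]
  refine Finset.prod_congr ?_ fun _ _ => rfl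
  ext e
  have hdiag := not_isDiag_of_runnable _ hP e
  induction e using Sym2.ind with
  | _ i j =>
    rw [Finset.mem_filter, List.mem_toFinset, SimpleGraph.mem_edgeFinset, SimpleGraph.mem_edgeSet]
    change _ ↔ i ≠ j ∧ Odd (P.cmds.countP (Pattern.isEnt i j))
    rw [countP_isEnt]
    constructor
    · rintro ⟨h1, h2⟩
      exact ⟨by simpa using hdiag h1, h2⟩
    · rintro ⟨-, h2⟩
      exact ⟨List.count_pos_iff.1 h2.pos, h2⟩

theorem prepMap_mulVec (I : Finset V) (ψ : (I → Bool) → ℂ) (x : V → Bool) :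
    (prepMap I *ᵥ ψ) x = (((Real.sqrt 2 : ℝ) : ℂ)⁻¹) ^ Iᶜ.card * ψ fun i => x i := by
  rw [Matrix.mulVec, dotProduct, Finset.sum_eq_single fun i : I => x i]
  · simp [prepMap, plusState_eq]
  · intro y _ hy
    simp only [prepMap, Matrix.of_apply]
    rw [if_neg, zero_mul]
    exact fun h => hy (funext fun i => (h i).symm)
  · simp

theorem padZero_mulVec (I : Finset V) (ψ : (I → Bool) → ℂ) :
    padZero I *ᵥ ψ = placeholder I fun x => ψ fun i => x i := by
  funext x
  rw [Matrix.mulVec, dotProduct, Finset.sum_eq_single fun i : I => x i]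
  · simp [padZero, placeholder]
  · intro y _ hy
    simp only [padZero, Matrix.of_apply]
    rw [if_neg, zero_mul]
    exact fun h => hy (funext fun i => (h.1 i).symm)
  · simp

/-- Extension of a string on `O` by zeros. -/
def padString (O : Finset V) (y : O → Bool) (i : V) : Bool := if h : i ∈ O then y ⟨i, h⟩ else false

theorem padZero_conjTranspose_mulVec (O : Finset V) (v : (V → Bool) → ℂ) (y : O → Bool) :
    ((padZero O)ᴴ *ᵥ v) y = v (padString O y) := by
  rw [Matrix.mulVec, dotProduct, Finset.sum_eq_single (padString O y)]
  · have h : (∀ i : O, padString O y i = y i) ∧ ∀ i, i ∉ O → padString O y i = false :=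
      ⟨fun i => by simp [padString], fun i hi => by simp [padString, hi]⟩
    simp only [padZero, Matrix.conjTranspose_apply, Matrix.of_apply]
    rw [if_pos h]; simp
  · intro x _ hx
    simp only [padZero, Matrix.conjTranspose_apply, Matrix.of_apply]
    rw [if_neg, star_zero, zero_mul]
    rintro ⟨h1, h2⟩
    apply hx
    funext i
    by_cases hi : i ∈ O
    · simpa [padString, hi] using h1 ⟨i, hi⟩
    · simpa [padString, hi] using h2 i hi
  · simp

/-- Output vectors are read as functions on the whole register that ignore the measured coordinates,
so that all stages of a pattern live in one space. -/
theorem branchMap_mulVec (P : Pattern V) (hP : P.Runnable) (α : V → ℝ) (s : P.Outcomes)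
    (ψ : (P.inputs → Bool) → ℂ) (x : V → Bool) :
    (P.branchMap α s *ᵥ ψ) (fun i => x i) =
      contractList (bra P.plane α (P.extend s)) P.measured
        (unitaryRun (P.extend s) P.cmds (prepMap P.inputs *ᵥ ψ)) x := by
  have h2 : ((Real.sqrt 2 : ℝ) : ℂ) ≠ 0 := by simp
  have hpad : padZero P.inputs *ᵥ ψ = placeholder P.inputs
      (((Real.sqrt 2 : ℝ) : ℂ) ^ ((P.inputs ∪ ∅)ᶜ.card) • (prepMap P.inputs *ᵥ ψ)) := by
    rw [padZero_mulVec]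
    congr 1
    funext x
    rw [Pi.smul_apply, prepMap_mulVec, smul_eq_mul, ← mul_assoc, Finset.union_empty, ← mul_pow,
      mul_inv_cancel₀ h2, one_pow, one_mul]
  have hindep : ∀ j, j ∉ P.inputs → IndepOf j (prepMap P.inputs *ᵥ ψ) := by
    intro j hj x b
    rw [prepMap_mulVec, prepMap_mulVec]
    congr 2
    funext i
    rw [Function.update_of_ne]
    rintro rfl; exact hj i.2
  rw [Pattern.branchMap, ← Matrix.mulVec_mulVec, ← Matrix.mulVec_mulVec, hpad,
    runOp_placeholder _ _ _ _ (Finset.disjoint_empty_right _) hP _ hindep,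
    padZero_conjTranspose_mulVec, placeholder, if_pos fun i hi => by simp [padString, hi]]
  refine apply_eq_of_indepOf (O := P.outputs) (fun j hj => indepOf_contractList _ ?_ _)
    fun i hi => by simp [padString, hi]
  exact ((measuredIn_of_runnable _ (Finset.disjoint_empty_right _) hP).2.2 j).2 (by simp [hj])

/-- The graph state vector `E_G N_{Iᶜ} ψ`. -/
def graphVec (G : SimpleGraph V) (I : Finset V) (ψ : (I → Bool) → ℂ) (x : V → Bool) : ℂ :=
  graphSign G x * (prepMap I *ᵥ ψ) x

theorem graphEmbedding_mulVec (G : SimpleGraph V) (I O : Finset V) (lam : V → Plane) (α : V → ℝ)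
    (ψ : (I → Bool) → ℂ) {L : List V} (hL : L.Nodup) (hLO : L.toFinset = Oᶜ) (x : V → Bool) :
    (graphEmbedding G I O lam α *ᵥ ψ) (fun i => x i) =
      contractList (bra lam α fun _ => false) L (graphVec G I ψ) x := by
  have hv : entMap G *ᵥ (prepMap I *ᵥ ψ) = graphVec G I ψ := by
    funext x
    simp only [entMap, Matrix.mulVec_diagonal, graphVec, graphSign]
  rw [graphEmbedding, ← Matrix.mulVec_mulVec, ← Matrix.mulVec_mulVec, hv, contractList_apply _ hL,
    Matrix.mulVec, dotProduct, hLO]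
  refine Finset.sum_congr rfl fun x₀ _ => ?_
  congr 1
  simp only [postselectMap, Matrix.of_apply, agreeOff, bra]
  have : (∀ i : O, x₀ i = x i) ↔ ∀ j, j ∉ Oᶜ → x j = x₀ j := by
    simp [eq_comm]
  by_cases h : ∀ i : O, x₀ i = x i
  · rw [if_pos h, if_pos (this.1 h), mul_one]
  · rw [if_neg h, if_neg (mt this.2 h), mul_zero]

end Pattern

/-! ### Pauli operators and their effect on the measurement bras. -/

section Pauli

variable {V : Type*} [DecidableEq V]

/-- The string `x` with the bits of `K` flipped. -/
def flip (K : Finset V) (x : V → Bool) : V → Bool := fun v => xor (x v) (decide (v ∈ K))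

/-- The character `x ↦ (-1)^{|x ∩ L|}`. -/
def chi (L : Finset V) (x : V → Bool) : ℂ := ∏ v ∈ L, if x v then -1 else 1

/-- The Pauli operator `Z_L X_K`. -/
def pauli (K L : Finset V) (w : (V → Bool) → ℂ) (x : V → Bool) : ℂ := chi L x * w (flip K x)

theorem pauli_add (K L : Finset V) (v w : (V → Bool) → ℂ) :
    pauli K L (v + w) = pauli K L v + pauli K L w := by
  funext x; simp [pauli, mul_add]

theorem pauli_smul (K L : Finset V) (c : ℂ) (w : (V → Bool) → ℂ) :
    pauli K L (c • w) = c • pauli K L w := by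
  funext x; simp only [pauli, Pi.smul_apply, smul_eq_mul]; ring

theorem chi_update {L : Finset V} {i : V} (hi : i ∉ L) (x : V → Bool) (b : Bool) :
    chi L (Function.update x i b) = chi L x := by
  refine Finset.prod_congr rfl fun v hv => ?_
  rw [Function.update_of_ne (by rintro rfl; exact hi hv)]

theorem flip_update {K : Finset V} {i : V} (hi : i ∉ K) (x : V → Bool) (b : Bool) :
    flip K (Function.update x i b) = Function.update (flip K x) i b := by
  funext v
  by_cases hv : v = i
  · subst hv; simp [flip, hi]
  · simp [flip, hv]

theorem pauli_contract {K L : Finset V} {i : V} (hK : i ∉ K) (hL : i ∉ L) (m : Bool → ℂ)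
    (w : (V → Bool) → ℂ) : pauli K L (contract i m w) = contract i m (pauli K L w) := by
  funext x
  simp only [pauli, contract, chi_update hL, flip_update hK]
  ring

theorem flip_empty (x : V → Bool) : flip ∅ x = x := by funext v; simp [flip]

theorem flip_singleton (i : V) (x : V → Bool) : flip {i} x = Function.update x i (!x i) := by
  funext v
  by_cases hv : v = i
  · subst hv; simp [flip]
  · simp [flip, hv]

theorem flip_flip (K K' : Finset V) (x : V → Bool) :
    flip K (flip K' x) = flip (symmDiff K K') x := by
  funext v
  by_cases hv : v ∈ K <;> by_cases hw : v ∈ K' <;> simp [flip, Finset.mem_symmDiff, hv, hw]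

/-- The bits flipped by the Pauli operator that exchanges the two outcomes in the plane `l`. -/
def planeFlips (l : Plane) (i : V) : Finset V :=
  match l with
  | .XY => ∅
  | .XZ => {i}
  | .YZ => {i}

/-- The bits whose phase enters the Pauli operator that exchanges the two outcomes in the plane
`l`. -/
def planeSigns (l : Plane) (i : V) : Finset V :=
  match l with
  | .XY => {i}
  | .XZ => {i}
  | .YZ => ∅

theorem planeFlips_subset (l : Plane) (i : V) : planeFlips l i ⊆ {i} := by
  cases l <;> simp [planeFlips]

theorem planeSigns_subset (l : Plane) (i : V) : planeSigns l i ⊆ {i} := by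
  cases l <;> simp [planeSigns]

/-- The Pauli operator on qubit `i` that exchanges the two outcomes in the plane `l`. -/
def planePauli (l : Plane) (i : V) (w : (V → Bool) → ℂ) : (V → Bool) → ℂ :=
  pauli (planeFlips l i) (planeSigns l i) w

/-- The bra of an outcome in the plane `l` at angle `a`. -/
def planeBra (l : Plane) (a : ℝ) (s b : Bool) : ℂ := star (measKet l a s b)

theorem bra_eq (lam : V → Plane) (α : V → ℝ) (s : V → Bool) (i : V) :
    bra lam α s i = planeBra (lam i) (α i) (s i) := rfl

/-- The operator is transposed onto the bra: `Z` for XY, `ZX` for XZ, `X` for YZ. -/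
theorem contract_planePauli (l : Plane) (i : V) (m : Bool → ℂ) (w : (V → Bool) → ℂ) :
    contract i m (planePauli l i w) = contract i (match l with
      | .XY => fun b => if b then -m true else m false
      | .XZ => fun b => if b then m false else -m true
      | .YZ => fun b => m !b) w := by
  funext x
  cases l <;>
    simp [contract, planePauli, planeFlips, planeSigns, pauli, chi, flip_empty, flip_singleton] <;>
    ring

/-- The point is the order of quantifiers: the plane is a great circle of the Bloch sphere, and one
Pauli is the antipodal map on all of it, so neither the Pauli nor `ω` depends on the angle. -/
theorem exists_planeBra_true (l : Plane) : ∃ ω : ℂ, ω ≠ 0 ∧ ∀ (a : ℝ) (i : V)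
    (w : (V → Bool) → ℂ), contract i (planeBra l a true) w =
      ω • contract i (planeBra l a false) (planePauli l i w) := by
  cases l with
  | XY =>
    refine ⟨1, one_ne_zero, fun a i w => ?_⟩
    rw [contract_planePauli, one_smul]
    congr 1
    have h : Real.pi / 2 / 2 = Real.pi / 4 := by ring
    funext b
    cases b <;> simp [planeBra, measKet, ketPlus, ketMinus, h, -Complex.ofReal_cos,
      -Complex.ofReal_sin]
  | XZ =>
    refine ⟨-1, by simp, fun a i w => ?_⟩
    rw [contract_planePauli, ← contract_smul]
    funext x
    simp [contract, planeBra, measKet, ketPlus, ketMinus]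
  | YZ =>
    refine ⟨Complex.I, Complex.I_ne_zero, fun a i w => ?_⟩
    rw [contract_planePauli]
    have h : Complex.exp (Complex.I * ((Real.pi / 2 : ℝ) : ℂ)) = Complex.I := by
      rw [mul_comm]; push_cast; exact Complex.exp_pi_div_two_mul_I
    funext x
    simp only [contract, planeBra, measKet, ketPlus, ketMinus, h, Pi.smul_apply, smul_eq_mul,
      Complex.star_def, map_neg, map_mul, Complex.conj_I, Complex.conj_ofReal,
      if_true, Bool.false_eq_true, if_false, Bool.not_false, Bool.not_true]
    linear_combination (((Real.sin (a / 2) : ℝ) : ℂ) * w (Function.update x i false)) *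
      Complex.I_mul_I

/-- The bras at the angles `0` and `π` of a plane form an orthonormal basis. -/
theorem planeBra_orthonormal (l : Plane) (a b : ℂ) :
    Complex.normSq (planeBra l 0 false false * a + planeBra l 0 false true * b) +
      Complex.normSq (planeBra l Real.pi false false * a + planeBra l Real.pi false true * b) =
      Complex.normSq a + Complex.normSq b := by
  have h : Real.pi / 2 / 2 = Real.pi / 4 := by ring
  have h2 : Real.sqrt 2 * Real.sqrt 2 = 2 := Real.mul_self_sqrt zero_le_two
  have he : Complex.exp (Complex.I * ((Real.pi / 2 : ℝ) : ℂ)) = Complex.I := by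
    rw [mul_comm]; push_cast; exact Complex.exp_pi_div_two_mul_I
  have he' : Complex.exp (Complex.I * ((Real.pi : ℝ) : ℂ)) = -1 := by
    rw [mul_comm]; exact Complex.exp_pi_mul_I
  cases l <;>
    simp only [planeBra, measKet, ketPlus, h, he, he', Real.cos_pi_div_four, Real.sin_pi_div_four,
      Bool.false_eq_true, if_false, Complex.normSq_apply, zero_div, Real.cos_zero, Real.sin_zero,
      Real.cos_pi_div_two, Real.sin_pi_div_two] <;>
    simp <;> ring_nf <;> simp only [Real.sq_sqrt zero_le_two] <;> ring

/-- Relations between the bras at the angles `0`, `π / 2` and `π`. -/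
theorem planeBra_relations (l : Plane) : ∃ p q ω₀ ω₁ : ℂ, p ≠ 0 ∧ q ≠ 0 ∧ ω₁ ≠ 0 ∧
    planeBra l (Real.pi / 2) false = p • planeBra l 0 false + q • planeBra l Real.pi false ∧
    (∀ (i : V) w, contract i (planeBra l 0 false) (planePauli l i w) =
      ω₀ • contract i (planeBra l Real.pi false) w) ∧
    (∀ (i : V) w, contract i (planeBra l Real.pi false) (planePauli l i w) =
      ω₁ • contract i (planeBra l 0 false) w) ∧
    ∀ z : ℂ, Complex.normSq z = 1 → Complex.normSq (p + q * z) = 1 → ω₀ * z ^ 2 = ω₁ := by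
  have h : Real.pi / 2 / 2 = Real.pi / 4 := by ring
  have he : Complex.exp (Complex.I * ((Real.pi / 2 : ℝ) : ℂ)) = Complex.I := by
    rw [mul_comm]; push_cast; exact Complex.exp_pi_div_two_mul_I
  have he' : Complex.exp (Complex.I * ((Real.pi : ℝ) : ℂ)) = -1 := by
    rw [mul_comm]; exact Complex.exp_pi_mul_I
  have hr : (((Real.sqrt 2 / 2 : ℝ) : ℂ)) ≠ 0 := by
    rw [Complex.ofReal_ne_zero]; positivity
  -- With `|z| = 1`, the condition `|1 + z|² = 2` forces `z` to be purely imaginary.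
  have hsq : ∀ z : ℂ, Complex.normSq z = 1 → Complex.normSq (((Real.sqrt 2 / 2 : ℝ) : ℂ) +
      ((Real.sqrt 2 / 2 : ℝ) : ℂ) * z) = 1 → z ^ 2 = -1 := by
    intro z h1 h2
    have h3 : Real.sqrt 2 ^ 2 = 2 := Real.sq_sqrt zero_le_two
    have e : ((Real.sqrt 2 / 2 : ℝ) : ℂ) + ((Real.sqrt 2 / 2 : ℝ) : ℂ) * z =
      ((Real.sqrt 2 / 2 : ℝ) : ℂ) * (1 + z) := by ring
    rw [e, Complex.normSq_mul, Complex.normSq_ofReal] at h2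
    simp only [Complex.normSq_apply, Complex.add_re, Complex.add_im, Complex.one_re,
      Complex.one_im] at h1 h2
    have h4 : z.re = 0 := by nlinarith
    have h5 : z.im ^ 2 = 1 := by rw [h4] at h1; linarith
    apply Complex.ext
    · simp [pow_two, h4]; linarith
    · simp [pow_two, h4]
  cases l with
  | XY =>
    -- The bras are proportional to `(1, 1)`, `(1, -1)` and `(1, -i)`, so `p + q = 1` and `p - q =
    -- -i`. The two norm conditions now force `z` to be real.
    refine ⟨(1 - Complex.I) / 2, (1 + Complex.I) / 2, 1, 1, ?_, ?_, one_ne_zero, ?_, ?_, ?_, ?_⟩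
    · intro h; simpa using congrArg Complex.re h
    · intro h; simpa using congrArg Complex.re h
    · funext b
      cases b <;> simp only [planeBra, measKet, ketPlus, he, he', Bool.false_eq_true, if_false,
        Pi.add_apply, Pi.smul_apply, smul_eq_mul] <;> simp [-Complex.ofReal_cos,
        -Complex.ofReal_sin] <;> ring
    · intro i w
      rw [contract_planePauli, one_smul]
      congr 1
      funext b
      cases b <;> simp [planeBra, measKet, ketPlus, he', -Complex.ofReal_cos,
        -Complex.ofReal_sin]
    · intro i w
      rw [contract_planePauli, one_smul]
      congr 1
      funext b
      cases b <;> simp [planeBra, measKet, ketPlus, he', -Complex.ofReal_cos,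
        -Complex.ofReal_sin]
    · intro z h1 h2
      simp only [Complex.normSq_apply] at h1 h2
      simp at h2
      have h4 : z.im = 0 := by nlinarith
      have h5 : z.re ^ 2 = 1 := by rw [h4] at h1; linarith
      apply Complex.ext
      · simp [pow_two, h4]; linarith
      · simp [pow_two, h4]
  | XZ =>
    refine ⟨_, _, 1, -1, hr, hr, by simp, ?_, ?_, ?_, fun z h1 h2 => ?_⟩
    · funext b
      cases b <;> simp [planeBra, measKet, ketPlus, h, -Complex.ofReal_cos, -Complex.ofReal_sin]
    · intro i w
      rw [contract_planePauli, ← contract_smul]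
      funext x
      simp [contract, planeBra, measKet, ketPlus]
    · intro i w
      rw [contract_planePauli, ← contract_smul]
      funext x
      simp [contract, planeBra, measKet, ketPlus]
    · rw [hsq z h1 h2]; simp
  | YZ =>
    refine ⟨_, _, Complex.I, -Complex.I, hr, hr, by simp, ?_, ?_, ?_, fun z h1 h2 => ?_⟩
    · funext b
      cases b <;> simp only [planeBra, measKet, ketPlus, h, he, Bool.false_eq_true, if_false,
        Pi.add_apply, Pi.smul_apply, smul_eq_mul, Real.cos_pi_div_four, Real.sin_pi_div_four,
        zero_div, Real.cos_zero, Real.sin_zero, Real.cos_pi_div_two, Real.sin_pi_div_two] <;>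
        simp
      ring
    · intro i w
      rw [contract_planePauli]
      funext x
      simp only [contract, planeBra, measKet, ketPlus, he, Bool.false_eq_true, if_false,
        Pi.smul_apply, smul_eq_mul, zero_div, Real.cos_zero, Real.sin_zero, Real.cos_pi_div_two,
        Real.sin_pi_div_two]
      simp [← mul_assoc]
    · intro i w
      rw [contract_planePauli]
      funext x
      simp only [contract, planeBra, measKet, ketPlus, he, Bool.false_eq_true, if_false,
        Pi.smul_apply, smul_eq_mul, zero_div, Real.cos_zero, Real.sin_zero, Real.cos_pi_div_two,
        Real.sin_pi_div_two]
      simp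
    · rw [hsq z h1 h2]; ring

end Pauli

/-! ### Norms of contracted vectors. -/

section Norm

variable {V : Type*} [Fintype V] [DecidableEq V]

/-- The squared norm of a vector of the register. -/
def sqNorm (w : (V → Bool) → ℂ) : ℝ := ∑ x, Complex.normSq (w x)

theorem sqNorm_smul (c : ℂ) (w : (V → Bool) → ℂ) :
    sqNorm (c • w) = Complex.normSq c * sqNorm w := by
  simp [sqNorm, Finset.mul_sum]

theorem eq_zero_of_sqNorm {w : (V → Bool) → ℂ} (h : sqNorm w = 0) : w = 0 := by
  funext x
  have := (Finset.sum_eq_zero_iff_of_nonneg fun x _ => Complex.normSq_nonneg (w x)).1 h x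
    (Finset.mem_univ x)
  simpa using this

theorem sqNorm_zero : sqNorm (0 : (V → Bool) → ℂ) = 0 := by simp [sqNorm]

/-- This is Parseval for the basis at angles `0` and `π`. The factor 2 arises because a contracted
vector is still summed over its idle coordinate `i`. -/
theorem sqNorm_contract_add (l : Plane) (i : V) (w : (V → Bool) → ℂ) :
    sqNorm (contract i (planeBra l 0 false) w) + sqNorm (contract i (planeBra l Real.pi false) w) =
      2 * sqNorm w := by
  have hflip : ∑ x, Complex.normSq (w (flip {i} x)) = sqNorm w := by
    refine Fintype.sum_equiv (Function.Involutive.toPerm (flip {i}) fun x => ?_) _ _ fun x => rfl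
    rw [flip_flip, symmDiff_self]
    exact flip_empty x
  rw [two_mul]
  nth_rewrite 2 [← hflip]
  simp only [sqNorm, ← Finset.sum_add_distrib]
  refine Finset.sum_congr rfl fun x _ => ?_
  rw [contract, contract, planeBra_orthonormal, flip_singleton]
  have hx : ∀ b, x i = b → Function.update x i b = x := fun b h => by
    rw [← h, Function.update_eq_self]
  cases h : x i
  · rw [hx _ h]; rfl
  · rw [hx _ h, add_comm]; rfl

theorem eq_of_contract_eq (l : Plane) (i : V) {v w : (V → Bool) → ℂ}
    (h₀ : contract i (planeBra l 0 false) v = contract i (planeBra l 0 false) w)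
    (h₁ : contract i (planeBra l Real.pi false) v = contract i (planeBra l Real.pi false) w) :
    v = w := by
  have hsub : ∀ m : Bool → ℂ, contract i m (v + (-1 : ℂ) • w) =
      contract i m v + (-1 : ℂ) • contract i m w := fun m => by
    rw [contract_add, contract_smul]
  have h := sqNorm_contract_add l i (v + (-1 : ℂ) • w)
  rw [hsub, hsub, h₀, h₁] at h
  simp only [neg_smul, one_smul, add_neg_cancel, sqNorm_zero] at h
  have := eq_zero_of_sqNorm (w := v + -w) (by linarith)
  rwa [← sub_eq_add_neg, sub_eq_zero] at this

end Norm

/-! ### From invariance after measurement at all angles to an eigenvector. -/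

section Eigen

variable {V : Type*} [Fintype V] [DecidableEq V]

/-- The relation reads `p (c₀ - c₂) v₀ = q (c₂ - c₁) v₁`: either `v₁` can be solved for, or `c₂ =
c₁` and then `v₀ ≠ 0` gives `c₀ = c₂`. -/
theorem eq_or_parallel {ι : Type*} {p q c₀ c₁ c₂ : ℂ} (hp : p ≠ 0) (hq : q ≠ 0) {v₀ v₁ : ι → ℂ}
    (h₀ : v₀ ≠ 0) (h : p • c₀ • v₀ + q • c₁ • v₁ = c₂ • (p • v₀ + q • v₁)) :
    c₀ = c₁ ∨ ∃ z : ℂ, v₁ = z • v₀ := by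
  have hx : ∀ x, p * (c₀ - c₂) * v₀ x = q * (c₂ - c₁) * v₁ x := fun x => by
    have := congrFun h x
    simp only [Pi.add_apply, Pi.smul_apply, smul_eq_mul] at this
    linear_combination this
  by_cases h21 : c₂ - c₁ = 0
  · left
    obtain ⟨x, hx0⟩ := Function.ne_iff.1 h₀
    have h1 := hx x
    rw [h21, mul_zero, zero_mul] at h1
    rcases mul_eq_zero.1 h1 with h2 | h2
    · rcases mul_eq_zero.1 h2 with h3 | h3
      · exact absurd h3 hp
      · linear_combination h3 + h21
    · exact absurd h2 hx0
  · right
    refine ⟨p * (c₀ - c₂) / (q * (c₂ - c₁)), funext fun x => ?_⟩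
    have hne : q * (c₂ - c₁) ≠ 0 := mul_ne_zero hq h21
    rw [Pi.smul_apply, smul_eq_mul, div_mul_eq_mul_div, eq_div_iff hne, hx x]
    ring

theorem zero_mem_angles : (0 : ℝ) ∈ Set.Icc 0 Real.pi := ⟨le_rfl, Real.pi_pos.le⟩

theorem pi_mem_angles : Real.pi ∈ Set.Icc 0 Real.pi := ⟨Real.pi_pos.le, le_rfl⟩

theorem pi_div_two_mem_angles : Real.pi / 2 ∈ Set.Icc 0 Real.pi :=
  ⟨by linarith [Real.pi_pos], by linarith [Real.pi_pos]⟩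

theorem ne_zero_of_sqNorm {w : (V → Bool) → ℂ} {n : ℝ} (hn : n ≠ 0) (h : sqNorm w = n) :
    w ≠ 0 := by
  rintro rfl
  exact hn (h ▸ sqNorm_zero)

/-- A Pauli operator whose effect on `v` cannot be seen, up to a factor, by measuring qubit `i` at
any angle has `v` as an eigenvector. -/
theorem eigen_of_contract (l : Plane) (i : V) {K L : Finset V} (hK : i ∉ K) (hL : i ∉ L)
    (v : (V → Bool) → ℂ) {n : ℝ} (hn : n ≠ 0)
    (hN : ∀ a ∈ Set.Icc 0 Real.pi, sqNorm (contract i (planeBra l a false) v) = n)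
    (h : ∀ a ∈ Set.Icc 0 Real.pi, ∃ c : ℂ,
      contract i (planeBra l a false) (planePauli l i (pauli K L v)) =
        c • contract i (planeBra l a false) v) :
    ∃ c : ℂ, planePauli l i (pauli K L v) = c • v := by
  obtain ⟨p, q, ω₀, ω₁, hp, hq, hω, hpq, h01, h10, hz⟩ := planeBra_relations (V := V) l
  obtain ⟨c₀, hc₀⟩ := h 0 zero_mem_angles
  obtain ⟨c₁, hc₁⟩ := h Real.pi pi_mem_angles
  obtain ⟨c₂, hc₂⟩ := h (Real.pi / 2) pi_div_two_mem_angles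
  have hN₀ := hN 0 zero_mem_angles
  have hN₁ := hN Real.pi pi_mem_angles
  have hN₂ := hN (Real.pi / 2) pi_div_two_mem_angles
  have hv₀ := ne_zero_of_sqNorm hn hN₀
  rw [hpq, contract_add_bra, contract_add_bra, hc₀, hc₁] at hc₂
  have hc : c₀ = c₁ := by
    rcases eq_or_parallel hp hq hv₀ hc₂ with hc | ⟨z, hzv⟩
    · exact hc
    · rw [hzv, sqNorm_smul, hN₀] at hN₁
      rw [hpq, contract_add_bra, hzv, smul_smul, ← add_smul, sqNorm_smul, hN₀] at hN₂
      -- In the parallel case the constant norm at the three angles pins down `z ^ 2`. Since the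
      -- plane Pauli exchanges the bras at `0` and `π`, the hypotheses become `ω₀ z P v₀ = c₀ v₀`
      -- and `ω₁ P v₀ = c₁ z v₀`, where `P = pauli K L` and `v₀` is the contraction at angle `0`;
      -- hence `c₀ = c₁`.
      have hz' := hz z (mul_right_cancel₀ hn (by rw [hN₁, one_mul]))
        (mul_right_cancel₀ hn (by rw [hN₂, one_mul]))
      rw [h01, ← pauli_contract hK hL, hzv, pauli_smul] at hc₀
      rw [h10, ← pauli_contract hK hL, hzv] at hc₁
      obtain ⟨x, hx⟩ := Function.ne_iff.1 hv₀
      have e₀ := congrFun hc₀ x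
      have e₁ := congrFun hc₁ x
      simp only [Pi.smul_apply, smul_eq_mul] at e₀ e₁
      refine mul_right_cancel₀ (mul_ne_zero hω hx) ?_
      rw [Pi.zero_apply] at *
      linear_combination (-ω₁) * e₀ + ω₀ * z * e₁ + c₁ * (contract i (planeBra l 0 false) v x) * hz'
  subst hc
  refine ⟨c₀, eq_of_contract_eq l i ?_ ?_⟩
  · rw [hc₀, contract_smul]
  · rw [hc₁, contract_smul]

/-- Fixing the angle of the first qubit of `J`, induction gives an eigenvector with an eigenvalue
that may depend on that angle. Equality of the eigenvalues at `0` and `π` suffices, because those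
two bras form a basis. -/
theorem eigen_of_contractList (lam : V → Plane) (i : V) {K L : Finset V} (J : List V)
    (hJ : (J ++ [i]).Nodup) (hK : ∀ j ∈ J ++ [i], j ∉ K) (hL : ∀ j ∈ J ++ [i], j ∉ L)
    (v : (V → Bool) → ℂ) {n : ℝ} (hn : n ≠ 0)
    (hN : ∀ α : V → ℝ, (∀ j, α j ∈ Set.Icc 0 Real.pi) →
      sqNorm (contractList (bra lam α fun _ => false) (J ++ [i]) v) = n)
    (h : ∀ α : V → ℝ, (∀ j, α j ∈ Set.Icc 0 Real.pi) → ∃ c : ℂ,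
      contractList (bra lam α fun _ => false) (J ++ [i]) (planePauli (lam i) i (pauli K L v)) =
        c • contractList (bra lam α fun _ => false) (J ++ [i]) v) :
    ∃ c : ℂ, planePauli (lam i) i (pauli K L v) = c • v := by
  induction J generalizing v with
  | nil =>
    exact eigen_of_contract (lam i) i (hK i (by simp)) (hL i (by simp)) v hn
      (fun a ha => hN (fun _ => a) fun _ => ha) fun a ha => h (fun _ => a) fun _ => ha
  | cons j J ih =>
    rw [List.cons_append, List.nodup_cons] at hJ
    have hji : i ≠ j := by rintro rfl; exact hJ.1 (by simp)
    have hcomm : ∀ (m : Bool → ℂ) w, planePauli (lam i) i (pauli K L (contract j m w)) =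
        contract j m (planePauli (lam i) i (pauli K L w)) := fun m w => by
      rw [pauli_contract (hK j (by simp)) (hL j (by simp)), planePauli, pauli_contract, planePauli]
      · exact fun hj => hji (Finset.mem_singleton.1 (planeFlips_subset _ _ hj)).symm
      · exact fun hj => hji (Finset.mem_singleton.1 (planeSigns_subset _ _ hj)).symm
    -- As `j` does not recur in the list, its angle can be varied without changing the other bras.
    have hlist : ∀ (α : V → ℝ) a w,
        contractList (bra lam (Function.update α j a) fun _ => false) (j :: (J ++ [i])) w =
        contractList (bra lam α fun _ => false) (J ++ [i])
          (contract j (planeBra (lam j) a false) w) := fun α a w => by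
      rw [contractList, bra_eq, Function.update_self]
      refine contractList_congr (fun k hk => ?_) _
      rw [bra_eq, bra_eq, Function.update_of_ne (by rintro rfl; exact hJ.1 hk)]
    have hadm : ∀ (α : V → ℝ) a, (∀ j, α j ∈ Set.Icc 0 Real.pi) → a ∈ Set.Icc 0 Real.pi →
        ∀ k, Function.update α j a k ∈ Set.Icc 0 Real.pi := fun α a hα ha k => by
      by_cases hk : k = j
      · subst hk; simpa using ha
      · simpa [hk] using hα k
    have hNj : ∀ a ∈ Set.Icc 0 Real.pi, ∀ α : V → ℝ, (∀ j, α j ∈ Set.Icc 0 Real.pi) →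
        sqNorm (contractList (bra lam α fun _ => false) (J ++ [i])
          (contract j (planeBra (lam j) a false) v)) = n := fun a ha α hα => by
      rw [← hlist]; exact hN _ (hadm α a hα ha)
    have key : ∀ a ∈ Set.Icc 0 Real.pi, ∃ c : ℂ,
        planePauli (lam i) i (pauli K L (contract j (planeBra (lam j) a false) v)) =
          c • contract j (planeBra (lam j) a false) v := fun a ha => by
      refine ih hJ.2 (fun k hk => hK k (by simp [hk])) (fun k hk => hL k (by simp [hk])) _
        (hNj a ha) fun α hα => ?_
      rw [hcomm, ← hlist, ← hlist]
      exact h _ (hadm α a hα ha)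
    obtain ⟨p, q, -, -, hp, hq, -, hpq, -, -, -⟩ := planeBra_relations (V := V) (lam j)
    obtain ⟨c₀, hc₀⟩ := key 0 zero_mem_angles
    obtain ⟨c₁, hc₁⟩ := key Real.pi pi_mem_angles
    obtain ⟨c₂, hc₂⟩ := key (Real.pi / 2) pi_div_two_mem_angles
    have hne : ∀ a ∈ Set.Icc 0 Real.pi, contract j (planeBra (lam j) a false) v ≠ 0 := by
      intro a ha h0
      have := hNj a ha (fun _ => 0) fun _ => zero_mem_angles
      rw [h0, ← zero_smul ℂ (0 : (V → Bool) → ℂ), contractList_smul, zero_smul, sqNorm_zero] at this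
      exact hn this.symm
    have hc : c₀ = c₁ := by
      have e := hc₂
      rw [hpq, contract_add_bra, pauli_add, pauli_smul, pauli_smul, planePauli, pauli_add,
        pauli_smul, pauli_smul] at e
      simp only [planePauli] at hc₀ hc₁
      rw [hc₀, hc₁] at e
      rcases eq_or_parallel hp hq (hne 0 zero_mem_angles) e with hc | ⟨z, hz⟩
      · exact hc
      -- The Pauli does not touch `j`, so parallel vectors trivially share an eigenvalue.
      · rw [hz, pauli_smul, pauli_smul, hc₀, ← hz, smul_comm, ← hz] at hc₁
        obtain ⟨x, hx⟩ := Function.ne_iff.1 (hne Real.pi pi_mem_angles)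
        exact mul_right_cancel₀ hx (congrFun hc₁ x)
    subst hc
    refine ⟨c₀, eq_of_contract_eq (lam j) j ?_ ?_⟩
    · rw [← hcomm, hc₀, contract_smul]
    · rw [← hcomm, hc₁, contract_smul]

end Eigen

/-! ### Products of Paulis, and moving corrections past entanglers. -/

section PauliCalculus

variable {V : Type*} [Fintype V] [DecidableEq V]

theorem chi_eq_prod_univ (L : Finset V) (x : V → Bool) :
    chi L x = ∏ v, if v ∈ L then (if x v then (-1 : ℂ) else 1) else 1 := by
  rw [chi, Finset.prod_ite_mem, Finset.univ_inter]

theorem chi_mul_chi (L L' : Finset V) (x : V → Bool) :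
    chi L x * chi L' x = chi (symmDiff L L') x := by
  simp only [chi_eq_prod_univ, ← Finset.prod_mul_distrib]
  refine Finset.prod_congr rfl fun v _ => ?_
  by_cases h : v ∈ L <;> by_cases h' : v ∈ L' <;> cases x v <;>
    simp [Finset.mem_symmDiff, h, h']

/-- The sign `(-1)^{|L ∩ K|}` is encoded as the character of `L` at the indicator string of `K`; it
is the commutation sign of `Z_L` and `X_K`. -/
theorem chi_flip (L K : Finset V) (x : V → Bool) :
    chi L (flip K x) = chi L (flip K fun _ => false) * chi L x := by
  simp only [chi, ← Finset.prod_mul_distrib]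
  refine Finset.prod_congr rfl fun v _ => ?_
  by_cases h : v ∈ K <;> cases hx : x v <;> simp [flip, h, hx]

theorem chi_ne_zero (L : Finset V) (x : V → Bool) : chi L x ≠ 0 := by
  refine Finset.prod_ne_zero_iff.2 fun v _ => ?_
  split_ifs <;> simp

theorem pauli_pauli (K L K' L' : Finset V) (w : (V → Bool) → ℂ) :
    pauli K L (pauli K' L' w) =
      chi L' (flip K fun _ => false) • pauli (symmDiff K K') (symmDiff L L') w := by
  funext x
  rw [Pi.smul_apply, pauli, pauli, pauli, chi_flip, flip_flip, symmDiff_comm K' K, ← chi_mul_chi,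
    smul_eq_mul]
  ring

theorem pauli_empty (w : (V → Bool) → ℂ) : pauli ∅ ∅ w = w := by
  funext x; simp [pauli, chi, flip_empty]

theorem pauli_contractList {K L : Finset V} (μ : V → Bool → ℂ) {J : List V}
    (hK : ∀ j ∈ J, j ∉ K) (hL : ∀ j ∈ J, j ∉ L) (w : (V → Bool) → ℂ) :
    pauli K L (contractList μ J w) = contractList μ J (pauli K L w) := by
  induction J generalizing w with
  | nil => rfl
  | cons j J ih =>
    rw [contractList, contractList, ih (fun k hk => hK k (by simp [hk]))
      (fun k hk => hL k (by simp [hk])), pauli_contract (hK j (by simp)) (hL j (by simp))]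

/-- An `X` on one end of a controlled-`Z` leaves a `Z` on the other end. -/
theorem czSign_flip {a b : V} (hab : a ≠ b) (i : V) (x : V → Bool) :
    czSign s(a, b) (flip {i} x) *
      chi (if i = a then {b} else if i = b then {a} else ∅) x = czSign s(a, b) x := by
  rw [czSign_mk, czSign_mk, flip_singleton]
  by_cases h1 : i = a
  · subst h1
    cases x i <;> cases h' : x b <;> simp [chi, h', hab.symm]
  · by_cases h2 : i = b
    · subst h2
      cases x i <;> cases h' : x a <;> simp [chi, h', hab, h1]
    · simp [h1, h2, chi, Ne.symm h1, Ne.symm h2, Function.update_of_ne]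

/-- The `Z` by-products of an `X` land on partners in later entanglers, which are live at that
moment; hence they avoid the qubits already measured. -/
theorem entSign_flip {O : Finset V} (cs : List (Command V)) {live done : Finset V}
    (hd : Disjoint live done) (hr : RunnableFrom O live done cs) (i : V) :
    ∃ N : Finset V, (∀ v ∈ N, v ∉ done) ∧
      ∀ x, entSign cs (flip {i} x) * chi N x = entSign cs x := by
  induction cs generalizing live done with
  | nil => exact ⟨∅, by simp, by simp [entSign, entPairs, chi]⟩
  | cons c cs ih =>
    cases c with
    | prep k => exact ih (disjoint_insert_live hd hr.2.1) hr.2.2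
    | meas k =>
      obtain ⟨N, h1, h2⟩ := ih (disjoint_measure hd k) hr.2
      exact ⟨N, fun v hv hv' => h1 v hv (by simp [hv']), h2⟩
    | ent a b =>
      obtain ⟨N, h1, h2⟩ := ih hd hr.2.2.2
      refine ⟨symmDiff (if i = a then {b} else if i = b then {a} else ∅) N, fun v hv => ?_,
        fun x => ?_⟩
      · rw [Finset.mem_symmDiff] at hv
        rcases hv with ⟨hv, -⟩ | ⟨hv, -⟩
        · split_ifs at hv
          · rw [Finset.mem_singleton.1 hv]; exact Finset.disjoint_left.1 hd hr.2.1
          · rw [Finset.mem_singleton.1 hv]; exact Finset.disjoint_left.1 hd hr.1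
          · simp at hv
        · exact h1 v hv
      · rw [entSign_cons_ent, entSign_cons_ent, ← chi_mul_chi, ← czSign_flip hr.2.2.1 i x, ← h2 x]
        ring
    | corrX k j => exact ih hd hr.2.2
    | corrZ k j => exact ih hd hr.2.2

/-- Moving the corrections past the entangling operators turns them into a Pauli operator, which
acts only on qubits that are measured after some qubit with outcome `1`. -/
theorem unitaryRun_eq_pauli {O : Finset V} (s : V → Bool) (cs : List (Command V))
    {live done : Finset V} (hd : Disjoint live done) (hr : RunnableFrom O live done cs) :
    ∃ (ε : ℂ) (K L : Finset V), ε ≠ 0 ∧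
      (∀ v, v ∈ K ∨ v ∈ L → v ∉ done ∧ ∃ j, s j = true ∧
        (j ∈ done ∨ (measuredIn cs).idxOf j < (measuredIn cs).idxOf v)) ∧
      ∀ w, unitaryRun s cs w = ε • pauli K L (fun x => entSign cs x * w x) := by
  induction cs generalizing live done with
  | nil =>
    refine ⟨1, ∅, ∅, one_ne_zero, by simp, fun w => ?_⟩
    simp [unitaryRun, entSign, entPairs, pauli_empty]
  | cons c cs ih =>
    -- Common treatment of both corrections: one that fires multiplies the Pauli of the remaining
    -- commands by another avoiding `done`, and the measured `j` is the required earlier outcome 1.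
    have corr : ∀ {i j : V}, i ∈ live → j ∈ done → RunnableFrom O live done cs →
        measuredIn (c :: cs) = measuredIn cs → entSign (c :: cs) = entSign cs →
        (s j = true → ∃ K' L' : Finset V, (∀ v, v ∈ K' ∨ v ∈ L' → v ∉ done) ∧
          ∀ w, (fun x => entSign cs x * unitaryStep s c w x) =
            pauli K' L' fun x => entSign cs x * w x) →
        (s j = false → ∀ w, unitaryStep s c w = w) →
        ∃ (ε : ℂ) (K L : Finset V), ε ≠ 0 ∧
          (∀ v, v ∈ K ∨ v ∈ L → v ∉ done ∧ ∃ j, s j = true ∧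
            (j ∈ done ∨ (measuredIn (c :: cs)).idxOf j < (measuredIn (c :: cs)).idxOf v)) ∧
          ∀ w, unitaryRun s (c :: cs) w = ε • pauli K L (fun x => entSign (c :: cs) x * w x) := by
      intro i j hi hj hr hm he hfire hidle
      obtain ⟨ε, K, L, hε, hsupp, h⟩ := ih hd hr
      rw [hm, he]
      cases hs : s j with
      | false => exact ⟨ε, K, L, hε, hsupp, fun w => by rw [unitaryRun, hidle hs, h]⟩
      | true =>
        obtain ⟨K', L', hsupp', h'⟩ := hfire hs
        refine ⟨ε * chi L' (flip K fun _ => false), symmDiff K K', symmDiff L L',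
          mul_ne_zero hε (chi_ne_zero _ _), fun v hv => ?_, fun w => ?_⟩
        · simp only [Finset.mem_symmDiff] at hv
          by_cases hv1 : v ∈ K ∨ v ∈ L
          · exact hsupp v hv1
          · exact ⟨hsupp' v (by tauto), j, hs, Or.inl hj⟩
        · rw [unitaryRun, h, h', pauli_pauli, smul_smul]
    cases c with
    | prep i => exact ih (disjoint_insert_live hd hr.2.1) hr.2.2
    | meas i =>
      obtain ⟨ε, K, L, hε, hsupp, h⟩ := ih (disjoint_measure hd i) hr.2
      refine ⟨ε, K, L, hε, fun v hv => ?_, h⟩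
      obtain ⟨h1, j, hj, h2⟩ := hsupp v hv
      simp only [Finset.mem_insert, not_or] at h1
      refine ⟨h1.2, j, hj, ?_⟩
      have e : measuredIn (Command.meas i :: cs) = i :: measuredIn cs := rfl
      -- An unmeasured qubit has `idxOf` equal to the length of the list, so outputs count as later
      -- than every measurement.
      rw [e, List.idxOf_cons_ne _ (Ne.symm h1.1)]
      by_cases hji : j = i
      · right; subst hji; simp
      · rw [List.idxOf_cons_ne _ (Ne.symm hji)]
        rcases h2 with h2 | h2
        · left; exact (Finset.mem_insert.1 h2).resolve_left hji
        · right; omega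
    | ent i k =>
      obtain ⟨ε, K, L, hε, hsupp, h⟩ := ih hd hr.2.2.2
      refine ⟨ε, K, L, hε, hsupp, fun w => ?_⟩
      rw [unitaryRun, h]
      congr 2
      funext x
      rw [entSign_cons_ent]; simp only [unitaryStep]; ring
    | corrX i j =>
      refine corr hr.1 hr.2.1 hr.2.2 rfl rfl (fun hs => ?_) fun hs w => by simp [unitaryStep, hs]
      obtain ⟨N, hN, hN'⟩ := entSign_flip cs hd hr.2.2 i
      refine ⟨{i}, N, fun v hv => ?_, fun w => ?_⟩
      · rcases hv with hv | hv
        · rw [Finset.mem_singleton.1 hv]; exact Finset.disjoint_left.1 hd hr.1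
        · exact hN v hv
      · funext x
        simp only [unitaryStep, hs, if_true, pauli]
        rw [← hN' x, flip_singleton]
        ring
    | corrZ i j =>
      refine corr hr.1 hr.2.1 hr.2.2 rfl rfl (fun hs => ?_) fun hs w => by simp [unitaryStep, hs]
      refine ⟨∅, {i}, fun v hv => ?_, fun w => ?_⟩
      · have hv : v = i := by simpa using hv
        rw [hv]; exact Finset.disjoint_left.1 hd hr.1
      · funext x
        simp only [unitaryStep, hs, if_true, pauli, flip_empty, chi, Finset.prod_singleton]
        ring

end PauliCalculus

/-! ### Truncated patterns. -/

section Stage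

variable {V : Type*} [Fintype V] [DecidableEq V]

/-- Qubits whose measurement is dropped stay live, which explains the shifted pair of sets. -/
theorem runnableFrom_filter {O M : Finset V} (hM : ∀ i ∈ M, i ∉ O) (cs : List (Command V))
    {live done : Finset V} (hd : Disjoint live done) (hr : RunnableFrom O live done cs) :
    RunnableFrom Mᶜ (live ∪ done \ M) (done ∩ M) (cs.filter (Pattern.keeps M)) := by
  induction cs generalizing live done with
  | nil =>
    obtain ⟨rfl, rfl⟩ := hr
    constructor
    · ext i
      have := hM i
      simp only [Finset.mem_union, Finset.mem_sdiff, Finset.mem_compl]; tauto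
    · ext i
      have := hM i
      simp only [Finset.mem_inter, Finset.mem_compl, not_not]; tauto
  | cons c cs ih =>
    cases c with
    | prep i =>
      rw [List.filter_cons_of_pos rfl]
      refine ⟨by simp [hr.1, hr.2.1], by simp [hr.2.1], ?_⟩
      have := ih (disjoint_insert_live hd hr.2.1) hr.2.2
      rwa [Finset.insert_union] at this
    | meas i =>
      have h := ih (disjoint_measure hd i) hr.2
      have hi : i ∉ done := Finset.disjoint_left.1 hd hr.1
      by_cases hiM : i ∈ M
      · rw [List.filter_cons_of_pos (by simpa [Pattern.keeps] using hiM)]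
        refine ⟨by simp [hr.1], ?_⟩
        convert h using 1
        · ext j; by_cases hj : j = i <;> simp [hj, hiM]
        · ext j; by_cases hj : j = i <;> simp [hj, hiM]
      · rw [List.filter_cons_of_neg (by simpa [Pattern.keeps] using hiM)]
        convert h using 1
        · ext j; by_cases hj : j = i <;> simp [hj, hiM, hr.1]
        · ext j; by_cases hj : j = i <;> simp [hj, hiM]
    | ent i k =>
      rw [List.filter_cons_of_pos rfl]
      exact ⟨by simp [hr.1], by simp [hr.2.1], hr.2.2.1, ih hd hr.2.2.2⟩
    | corrX i j =>
      by_cases hj : j ∈ M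
      · rw [List.filter_cons_of_pos (by simpa [Pattern.keeps] using hj)]
        exact ⟨by simp [hr.1], by simp [hr.2.1, hj], ih hd hr.2.2⟩
      · rw [List.filter_cons_of_neg (by simpa [Pattern.keeps] using hj)]
        exact ih hd hr.2.2
    | corrZ i j =>
      by_cases hj : j ∈ M
      · rw [List.filter_cons_of_pos (by simpa [Pattern.keeps] using hj)]
        exact ⟨by simp [hr.1], by simp [hr.2.1, hj], ih hd hr.2.2⟩
      · rw [List.filter_cons_of_neg (by simpa [Pattern.keeps] using hj)]
        exact ih hd hr.2.2

theorem measuredIn_filter (M : Finset V) (cs : List (Command V)) :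
    measuredIn (cs.filter (Pattern.keeps M)) = (measuredIn cs).filter fun i => decide (i ∈ M) := by
  induction cs with
  | nil => rfl
  | cons c cs ih =>
    cases c with
    | prep i => rw [List.filter_cons_of_pos rfl]; exact ih
    | ent i k => rw [List.filter_cons_of_pos rfl]; exact ih
    | meas i =>
      have e : ∀ cs, measuredIn (Command.meas i :: cs) = i :: measuredIn cs := fun _ => rfl
      by_cases hi : i ∈ M
      · rw [List.filter_cons_of_pos (by simpa [Pattern.keeps] using hi), e, e, ih,
          List.filter_cons_of_pos (by simpa using hi)]
      · rw [List.filter_cons_of_neg (by simpa [Pattern.keeps] using hi), e, ih,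
          List.filter_cons_of_neg (by simpa using hi)]
    | corrX i j =>
      by_cases hj : j ∈ M
      · rw [List.filter_cons_of_pos (by simpa [Pattern.keeps] using hj)]; exact ih
      · rw [List.filter_cons_of_neg (by simpa [Pattern.keeps] using hj)]; exact ih
    | corrZ i j =>
      by_cases hj : j ∈ M
      · rw [List.filter_cons_of_pos (by simpa [Pattern.keeps] using hj)]; exact ih
      · rw [List.filter_cons_of_neg (by simpa [Pattern.keeps] using hj)]; exact ih

variable {P : Pattern V}

theorem measured_nodup (hP : P.Runnable) : P.measured.Nodup :=
  (measuredIn_of_runnable _ (Finset.disjoint_empty_right _) hP).1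

theorem mem_measured (hP : P.Runnable) (i : V) : i ∈ P.measured ↔ i ∉ P.outputs := by
  exact ((measuredIn_of_runnable _ (Finset.disjoint_empty_right _) hP).2.2 i).trans (by simp)

theorem stage_runnable (hP : P.Runnable) (k : ℕ) : (P.stage k).Runnable := by
  have h := runnableFrom_filter (M := (P.measured.take k).toFinset) (fun i hi =>
    (mem_measured hP i).1 (List.mem_of_mem_take (List.mem_toFinset.1 hi))) P.cmds
    (Finset.disjoint_empty_right _) hP
  rw [Finset.empty_sdiff, Finset.union_empty, Finset.empty_inter] at h
  exact h

theorem stage_measured (hP : P.Runnable) (k : ℕ) :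
    (P.stage k).measured = P.measured.take k := by
  have h := measuredIn_filter (P.measured.take k).toFinset P.cmds
  have e : measuredIn P.cmds = P.measured.take k ++ P.measured.drop k :=
    (List.take_append_drop k P.measured).symm
  have hn := measured_nodup hP
  rw [← List.take_append_drop k P.measured, List.nodup_append] at hn
  have h1 : (P.measured.take k).filter (fun i => decide (i ∈ (P.measured.take k).toFinset)) =
      P.measured.take k := List.filter_eq_self.2 fun i hi => by simpa using hi
  have h2 : (P.measured.drop k).filter (fun i => decide (i ∈ (P.measured.take k).toFinset)) =
      [] := List.filter_eq_nil_iff.2 fun i hi hi' => by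
    rw [decide_eq_true_eq, List.mem_toFinset] at hi'
    exact hn.2.2 i hi' i hi rfl
  rw [e, List.filter_append, h1, h2, List.append_nil] at h
  exact h

theorem stage_graph (P : Pattern V) (k : ℕ) : (P.stage k).graph = P.graph := by
  ext i j
  change i ≠ j ∧ Odd ((P.cmds.filter _).countP _) ↔ i ≠ j ∧ Odd (P.cmds.countP _)
  rw [List.countP_filter]
  have : ∀ c : Command V, (Pattern.isEnt i j c && Pattern.keeps (P.measured.take k).toFinset c) =
      Pattern.isEnt i j c := by
    intro c; cases c <;> simp [Pattern.isEnt, Pattern.keeps]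
  simp only [this]

end Stage

/-! ### Consequences of determinism for the branch vectors. -/

section Determinism

variable {V : Type*} [Fintype V] [DecidableEq V] {P : Pattern V}

theorem dotProduct_star_self_eq {ι : Type*} [Fintype ι] (v : ι → ℂ) :
    v ⬝ᵥ star v = ((∑ y, Complex.normSq (v y) : ℝ) : ℂ) := by
  simp [dotProduct, Complex.mul_conj]

theorem channel_pure (P : Pattern V) (α : V → ℝ) (ψ : (P.inputs → Bool) → ℂ) :
    P.channel α (Matrix.vecMulVec ψ (star ψ)) =
      ∑ s, Matrix.vecMulVec (P.branchMap α s *ᵥ ψ) (star (P.branchMap α s *ᵥ ψ)) := by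
  refine Finset.sum_congr rfl fun s _ => ?_
  rw [Matrix.mul_vecMulVec, Matrix.vecMulVec_mul, Matrix.star_mulVec]

theorem sum_normSq_branch {α : V → ℝ} (h : P.Deterministic α) {ψ : (P.inputs → Bool) → ℂ}
    (hψ : star ψ ⬝ᵥ ψ = 1) :
    ∑ s, ∑ y, Complex.normSq ((P.branchMap α s *ᵥ ψ) y) = 1 := by
  obtain ⟨φ, hφ, hc⟩ := h ψ hψ
  rw [channel_pure] at hc
  have := congrArg Matrix.trace hc
  rw [Matrix.trace_sum] at this
  simp only [Matrix.trace_vecMulVec] at this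
  rw [dotProduct_comm φ, hφ] at this
  simp only [dotProduct_star_self_eq] at this
  exact_mod_cast this

/-- Evaluating both sides on the component `u` of `v t` orthogonal to `φ` turns the left side into a
sum of squares equal to zero, so `u` is orthogonal to `v t` and hence vanishes. -/
theorem branch_mem_span {ι κ : Type*} [Fintype ι] [Fintype κ] {v : κ → ι → ℂ} {φ : ι → ℂ}
    (hφ : star φ ⬝ᵥ φ = 1)
    (h : ∑ s, Matrix.vecMulVec (v s) (star (v s)) = Matrix.vecMulVec φ (star φ)) (t : κ) :
    ∃ c : ℂ, v t = c • φ := by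
  set u : ι → ℂ := v t - (star φ ⬝ᵥ v t) • φ with hu
  have hφu : star φ ⬝ᵥ u = 0 := by
    rw [hu, dotProduct_sub, dotProduct_smul, hφ, smul_eq_mul, mul_one, sub_self]
  have huφ : star u ⬝ᵥ φ = 0 := by
    rw [Matrix.star_dotProduct, hφu, star_zero]
  have hsum : ∑ s, Complex.normSq (star u ⬝ᵥ v s) = 0 := by
    have h1 := congrArg (fun M => star u ⬝ᵥ (M *ᵥ u)) h
    simp only [Matrix.sum_mulVec, dotProduct_sum, Matrix.vecMulVec_mulVec, hφu] at h1
    have h2 : ∀ s, star u ⬝ᵥ (MulOpposite.op (star (v s) ⬝ᵥ u) • v s) =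
        ((Complex.normSq (star u ⬝ᵥ v s) : ℝ) : ℂ) := fun s => by
      have h3 : star (v s) ⬝ᵥ u = star (star u ⬝ᵥ v s) :=
        Matrix.star_dotProduct _ _
      rw [h3, op_smul_eq_smul, dotProduct_smul, smul_eq_mul, mul_comm]
      exact Complex.mul_conj _
    simp only [h2] at h1
    have h4 : ((∑ s, Complex.normSq (star u ⬝ᵥ v s) : ℝ) : ℂ) = 0 := by
      push_cast; rw [h1]; simp
    exact_mod_cast h4
  have ht : star u ⬝ᵥ v t = 0 := by
    have := (Finset.sum_eq_zero_iff_of_nonneg fun s _ => Complex.normSq_nonneg _).1 hsum t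
      (Finset.mem_univ t)
    simpa using this
  have huu : star u ⬝ᵥ u = 0 := by
    nth_rewrite 2 [hu]
    rw [dotProduct_sub, dotProduct_smul, ht, huφ, smul_zero, sub_zero]
  refine ⟨star φ ⬝ᵥ v t, sub_eq_zero.1 ?_⟩
  rw [dotProduct_comm, dotProduct_star_self_eq] at huu
  have huu' : ∑ y, Complex.normSq (u y) = 0 := by exact_mod_cast huu
  funext y
  have := (Finset.sum_eq_zero_iff_of_nonneg fun s _ => Complex.normSq_nonneg _).1 huu' y
    (Finset.mem_univ y)
  exact Complex.normSq_eq_zero.1 this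

theorem branch_parallel {α : V → ℝ} (h : P.Deterministic α) {ψ : (P.inputs → Bool) → ℂ}
    (hψ : star ψ ⬝ᵥ ψ = 1) (s t : P.Outcomes) (ht : P.branchMap α t *ᵥ ψ ≠ 0) :
    ∃ c : ℂ, P.branchMap α s *ᵥ ψ = c • (P.branchMap α t *ᵥ ψ) := by
  obtain ⟨φ, hφ, hc⟩ := h ψ hψ
  rw [channel_pure] at hc
  obtain ⟨a, ha⟩ := branch_mem_span hφ hc s
  obtain ⟨b, hb⟩ := branch_mem_span hφ hc t
  have hb0 : b ≠ 0 := by rintro rfl; exact ht (by rw [hb, zero_smul])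
  refine ⟨a / b, ?_⟩
  rw [ha, hb, smul_smul, div_mul_cancel₀ _ hb0]

theorem sum_restrict (O : Finset V) (f : (O → Bool) → ℝ) :
    ∑ x : V → Bool, f (fun i => x i) =
      ∑ _s : {i // i ∉ O} → Bool, ∑ y, f y := by
  rw [← (Equiv.piEquivPiSubtypeProd (fun i => i ∈ O) fun _ => Bool).symm.sum_comp,
    Fintype.sum_prod_type, Finset.sum_comm]
  refine Finset.sum_congr rfl fun s _ => Finset.sum_congr rfl fun y _ => ?_
  congr 1
  funext i
  simp [Equiv.piEquivPiSubtypeProd]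

theorem extend_false (P : Pattern V) : P.extend (fun _ => false) = fun _ => false := by
  funext i; simp [Pattern.extend]

theorem branchMap_false_mulVec (hP : P.Runnable) (α : V → ℝ) (ψ : (P.inputs → Bool) → ℂ)
    (x : V → Bool) :
    (P.branchMap α (fun _ => false) *ᵥ ψ) (fun i => x i) =
      contractList (bra P.plane α fun _ => false) P.measured (graphVec P.graph P.inputs ψ) x := by
  rw [branchMap_mulVec P hP, extend_false, unitaryRun_false, entSign_eq_graphSign P hP]
  rfl

theorem normSq_branch_eq {α : V → ℝ} (h : P.StronglyDeterministic α) (ψ : (P.inputs → Bool) → ℂ)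
    (s t : P.Outcomes) (y : P.outputs → Bool) :
    Complex.normSq ((P.branchMap α s *ᵥ ψ) y) = Complex.normSq ((P.branchMap α t *ᵥ ψ) y) := by
  obtain ⟨θ, hθ⟩ := h s t
  rw [hθ, Matrix.smul_mulVec, Pi.smul_apply, smul_eq_mul, Complex.normSq_mul,
    Complex.normSq_eq_norm_sq, mul_comm Complex.I, Complex.norm_exp_ofReal_mul_I]
  simp

/-- No normalizing factor is needed: the sum over the register counts each output string once per
string on the measured qubits, that is, once per branch, and all branches have equal norm. -/
theorem sqNorm_contractList_measured (hP : P.Runnable) {α : V → ℝ} (h : P.Deterministic α)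
    (h' : P.StronglyDeterministic α) {ψ : (P.inputs → Bool) → ℂ} (hψ : star ψ ⬝ᵥ ψ = 1) :
    sqNorm (contractList (bra P.plane α fun _ => false) P.measured
      (graphVec P.graph P.inputs ψ)) = 1 := by
  have e : sqNorm (contractList (bra P.plane α fun _ => false) P.measured
      (graphVec P.graph P.inputs ψ)) = ∑ x : V → Bool,
        Complex.normSq ((P.branchMap α (fun _ => false) *ᵥ ψ) fun i => x i) :=
    Finset.sum_congr rfl fun x _ => by rw [branchMap_false_mulVec hP]
  rw [e, sum_restrict P.outputs fun y =>
    Complex.normSq ((P.branchMap α (fun _ => false) *ᵥ ψ) y), ← sum_normSq_branch h hψ]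
  exact Finset.sum_congr rfl fun s _ => Finset.sum_congr rfl fun y _ => normSq_branch_eq h' ψ _ _ y

/-- Norms are traced back from the full pattern: if one more contraction gives norm 1 at both angles
`0` and `π`, then `sqNorm_contract_add` gives norm 1 without it. -/
theorem sqNorm_contractList_of_append (lam : V → Plane) (v : (V → Bool) → ℂ) (L' L : List V)
    (hL : (L ++ L').Nodup) (h : ∀ α : V → ℝ, (∀ j, α j ∈ Set.Icc 0 Real.pi) →
      sqNorm (contractList (bra lam α fun _ => false) (L ++ L') v) = 1)
    (α : V → ℝ) (hα : ∀ j, α j ∈ Set.Icc 0 Real.pi) :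
    sqNorm (contractList (bra lam α fun _ => false) L v) = 1 := by
  induction L' generalizing L α with
  | nil => simpa using h α hα
  | cons j L' ih =>
    have e : L ++ j :: L' = (L ++ [j]) ++ L' := by simp
    have hj : j ∉ L := by
      rw [List.nodup_append] at hL
      exact fun hj => hL.2.2 j hj j (by simp) rfl
    have key : ∀ a ∈ Set.Icc 0 Real.pi, sqNorm (contract j (planeBra (lam j) a false)
        (contractList (bra lam α fun _ => false) L v)) = 1 := fun a ha => by
      have h1 := ih (L ++ [j]) (e ▸ hL) (by rwa [e] at h) (Function.update α j a) fun k => by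
        by_cases hk : k = j
        · subst hk; simpa using ha
        · simpa [hk] using hα k
      rw [contractList_append, contractList, contractList, bra_eq, Function.update_self] at h1
      rwa [contractList_congr (ν := bra lam α fun _ => false)] at h1
      intro k hk
      rw [bra_eq, bra_eq, Function.update_of_ne (by rintro rfl; exact hj hk)]
    have := sqNorm_contract_add (lam j) j (contractList (bra lam α fun _ => false) L v)
    rw [key 0 zero_mem_angles, key _ pi_mem_angles] at this
    linarith

end Determinism

/-! ### Pauli operators stabilizing the graph states. -/

section GraphStabilizer

variable {V : Type*} [Fintype V] [DecidableEq V]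

theorem graphSign_ne_zero (G : SimpleGraph V) (x : V → Bool) : graphSign G x ≠ 0 := by
  refine Finset.prod_ne_zero_iff.2 fun e _ => ?_
  unfold czSign; split_ifs <;> simp

-- Only edges at `u` change sign, and they correspond to the neighbours of `u`: this is `E_G X_u =
-- X_u Z_{N(u)} E_G` up to the order of factors.
open Classical in
theorem graphSign_flip (G : SimpleGraph V) (u : V) (x : V → Bool) :
    graphSign G (flip {u} x) = graphSign G x * chi (G.neighborFinset u) x := by
  have h1 : ∀ e ∈ G.edgeFinset, czSign e (flip {u} x) =
      czSign e x * if u ∈ e then czSign e x * czSign e (flip {u} x) else 1 := by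
    intro e _
    split_ifs with h
    · rw [← mul_assoc, czSign_mul_self, one_mul]
    · rw [mul_one, flip_singleton]
      unfold czSign
      refine if_congr (forall_congr' fun i => forall_congr' fun hi => ?_) rfl rfl
      rw [Function.update_of_ne (by rintro rfl; exact h hi)]
  rw [graphSign, Finset.prod_congr rfl h1, Finset.prod_mul_distrib, graphSign]
  congr 1
  rw [← Finset.prod_filter]
  have h2 : G.edgeFinset.filter (fun e => u ∈ e) = (G.neighborFinset u).image fun v => s(u, v) := by
    ext e
    simp only [Finset.mem_filter, SimpleGraph.mem_edgeFinset, Finset.mem_image,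
      SimpleGraph.mem_neighborFinset]
    constructor
    · rintro ⟨he, hu⟩
      obtain ⟨v, rfl⟩ := hu
      exact ⟨v, he, rfl⟩
    · rintro ⟨v, hv, rfl⟩
      exact ⟨hv, by simp⟩
  rw [h2, Finset.prod_image fun a _ b _ h => Sym2.congr_right.1 h, chi]
  refine Finset.prod_congr rfl fun v hv => ?_
  have huv : v ≠ u := by
    rintro rfl; simp at hv
  rw [czSign_mk, czSign_mk, flip_singleton]
  cases h : x u <;> cases h' : x v <;> simp [huv, h']

theorem graphVec_eq (G : SimpleGraph V) (I : Finset V) (ψ : (I → Bool) → ℂ) (x : V → Bool) :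
    graphVec G I ψ x =
      graphSign G x * ((((Real.sqrt 2 : ℝ) : ℂ)⁻¹) ^ Iᶜ.card * ψ fun i => x i) := by
  rw [graphVec, prepMap_mulVec]

open Classical in
theorem mem_oddNbhd_iff (G : SimpleGraph V) (K : Finset V) (u : V) :
    u ∈ oddNbhd G K ↔ chi (G.neighborFinset u) (flip K fun _ => false) = -1 := by
  have h1 : (G.neighborSet u ∩ (K : Set V)).ncard = (G.neighborFinset u ∩ K).card := by
    rw [← Set.ncard_coe_finset]; congr 1; ext v; simp
  have h2 : chi (G.neighborFinset u) (flip K fun _ => false) =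
      (-1) ^ (G.neighborFinset u ∩ K).card := by
    rw [chi, ← Finset.filter_mem_eq_inter, ← Finset.prod_const, Finset.prod_filter]
    refine Finset.prod_congr rfl fun v _ => ?_
    by_cases hv : v ∈ K <;> simp [flip, hv]
  change Odd _ ↔ _
  rw [h1, h2]
  rcases Nat.even_or_odd (G.neighborFinset u ∩ K).card with h | h
  · rw [h.neg_one_pow]
    refine ⟨fun h' => absurd h (Nat.not_even_iff_odd.2 h'), fun h' => ?_⟩
    norm_num at h'
  · rw [h.neg_one_pow]; simp [h]

/-- A Pauli operator of which all the graph state vectors are eigenvectors flips no input, and its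
phases are those of the corresponding product of stabilizers. -/
theorem stabilizer_of_eigen {G : SimpleGraph V} {I K L : Finset V}
    (h : ∀ ψ : (I → Bool) → ℂ, star ψ ⬝ᵥ ψ = 1 →
      ∃ c : ℂ, pauli K L (graphVec G I ψ) = c • graphVec G I ψ) :
    (∀ v ∈ K, v ∉ I) ∧ ∀ u, u ∈ L ↔ u ∈ oddNbhd G K := by
  classical
  have hs : (((Real.sqrt 2 : ℝ) : ℂ)⁻¹) ^ Iᶜ.card ≠ 0 := by
    simp
  constructor
  · intro v hv hvI
    -- With input `|0…0⟩` the graph state vanishes off the strings that are zero on `I`; flipping an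
    -- input would move the support.
    obtain ⟨c, hc⟩ := h (Pi.single (fun _ => false) 1) (by simp)
    have hx := congrFun hc (flip K fun _ => false)
    rw [pauli, flip_flip, symmDiff_self, Finset.bot_eq_empty, flip_empty, Pi.smul_apply,
      smul_eq_mul, graphVec_eq, graphVec_eq, Pi.single_eq_same, Pi.single_eq_of_ne] at hx
    · simp only [mul_zero, mul_one] at hx
      exact mul_ne_zero (chi_ne_zero _ _) (mul_ne_zero (graphSign_ne_zero _ _) hs) hx
    · intro h'
      simpa [flip, hv] using congrFun h' ⟨v, hvI⟩
  -- With the uniform input every amplitude is a nonzero constant times a sign; comparing the zero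
  -- string with the indicator of `u` eliminates the eigenvalue.
  · set a : ℂ := ((Real.sqrt (Fintype.card (I → Bool)) : ℝ) : ℂ)⁻¹ with ha
    have hpos : (0 : ℝ) < Fintype.card (I → Bool) := by exact_mod_cast Fintype.card_pos
    have ha0 : a ≠ 0 := by
      refine inv_ne_zero ?_
      rw [Complex.ofReal_ne_zero]
      exact (Real.sqrt_pos.2 hpos).ne'
    obtain ⟨c, hc⟩ := h (fun _ => a) (by
      simp only [dotProduct, Pi.star_apply, Finset.sum_const, Finset.card_univ, nsmul_eq_mul]
      rw [ha, ← Complex.ofReal_inv, Complex.star_def, Complex.conj_ofReal, ← Complex.ofReal_mul,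
        ← mul_inv, Real.mul_self_sqrt hpos.le]
      push_cast
      exact mul_inv_cancel₀ (by exact_mod_cast hpos.ne'))
    have hx : ∀ x, chi L x * graphSign G (flip K x) = c * graphSign G x := fun x => by
      have := congrFun hc x
      rw [pauli, Pi.smul_apply, smul_eq_mul, graphVec_eq, graphVec_eq, ← mul_assoc,
        ← mul_assoc] at this
      refine mul_right_cancel₀ (mul_ne_zero hs ha0) ?_
      linear_combination this
    intro u
    have e0 := hx fun _ => false
    have e1 := hx (flip {u} fun _ => false)
    have c0 : ∀ N : Finset V, chi N (fun _ => false) = 1 := fun N => by simp [chi]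
    rw [flip_flip, symmDiff_comm, ← flip_flip, graphSign_flip, graphSign_flip, c0, mul_one, ← e0,
      c0, one_mul] at e1
    have e2 : chi L (flip {u} fun _ => false) *
        chi (G.neighborFinset u) (flip K fun _ => false) = 1 := by
      refine mul_right_cancel₀ (graphSign_ne_zero G (flip K fun _ => false)) ?_
      linear_combination e1
    have e3 : chi L (flip {u} fun _ => false) = if u ∈ L then -1 else 1 := by
      rw [chi, ← Finset.prod_ite_eq L u fun _ => (-1 : ℂ)]
      refine Finset.prod_congr rfl fun v _ => ?_
      simp [flip, eq_comm]
    rw [mem_oddNbhd_iff]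
    rw [e3] at e2
    by_cases hu : u ∈ L
    · rw [if_pos hu] at e2
      exact ⟨fun _ => by linear_combination -e2, fun _ => hu⟩
    · rw [if_neg hu, one_mul] at e2
      refine ⟨fun h => absurd h hu, fun h => ?_⟩
      rw [e2] at h
      norm_num at h

end GraphStabilizer

/-! ### Construction of the generalized flow. -/

section Flow

variable {V : Type*} [Fintype V] [DecidableEq V] {P : Pattern V}

/-- For the measurement order `A ++ i :: B` there is a Pauli operator that acts trivially on `A`,
exchanges the two outcomes of the measurement of `i`, and has all the graph state vectors as
eigenvectors. -/
theorem exists_correction (hP : P.Runnable) (hdet : P.UniformlyStronglyStepwiseDeterministic)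
    {A B : List V} {i : V} (hm : P.measured = A ++ i :: B) :
    ∃ K L : Finset V, (∀ v, v ∈ K ∨ v ∈ L → v ∉ A) ∧
      (i ∈ K ↔ i ∈ planeFlips (P.plane i) i) ∧ (i ∈ L ↔ i ∈ planeSigns (P.plane i) i) ∧
      ∀ ψ : (P.inputs → Bool) → ℂ, star ψ ⬝ᵥ ψ = 1 → ∃ c : ℂ,
        pauli K L (graphVec P.graph P.inputs ψ) = c • graphVec P.graph P.inputs ψ := by
  have htake : P.measured.take (A.length + 1) = A ++ [i] := by
    rw [hm, List.take_append]; simp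
  have hnod := measured_nodup hP
  have hm' : P.measured = (A ++ [i]) ++ B := by simp [hm]
  have hnodA : (A ++ [i]).Nodup := (List.nodup_append.1 (hm' ▸ hnod)).1
  have hiA : i ∉ A := fun h => (List.nodup_append.1 hnodA).2.2 i h i (by simp) rfl
  set Q := P.stage (A.length + 1) with hQ
  have hQr : Q.Runnable := stage_runnable hP _
  have hQm : Q.measured = A ++ [i] := (stage_measured hP _).trans htake
  have hQg : Q.graph = P.graph := stage_graph P _
  have hiO : i ∉ Q.outputs := (mem_measured hQr i).1 (by simp [hQm])
  -- Since `i` is measured last in this stage, the corrections fired by its outcome act only on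
  -- unmeasured qubits.
  let t : Q.Outcomes := fun j => decide (j.1 = i)
  have ht : Q.extend t = fun j => decide (j = i) := by
    funext j
    by_cases hj : j = i
    · subst hj; simp [Pattern.extend, hiO, t]
    · simp [Pattern.extend, hj, t]
  obtain ⟨ε, K, L, hε, hsupp, hrun⟩ := unitaryRun_eq_pauli (Q.extend t) Q.cmds
    (Finset.disjoint_empty_right _) hQr
  have hsupp' : ∀ v, v ∈ K ∨ v ∈ L → v ∉ A ++ [i] := by
    intro v hv hvA
    obtain ⟨-, j, hj, h⟩ := hsupp v hv
    rw [ht] at hj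
    have hji : j = i := by simpa using hj
    subst hji
    have h := h.resolve_left (by simp)
    change Q.measured.idxOf j < Q.measured.idxOf v at h
    rw [hQm] at h
    have h1 := List.idxOf_lt_length_iff.2 hvA
    rw [List.idxOf_append_of_notMem hiA] at h
    simp at h h1
    omega
  have hK : ∀ j ∈ A ++ [i], j ∉ K := fun j hj h => hsupp' j (Or.inl h) hj
  have hL : ∀ j ∈ A ++ [i], j ∉ L := fun j hj h => hsupp' j (Or.inr h) hj
  have hF : ∀ j ∈ A, j ∉ planeFlips (P.plane i) i := fun j hj h =>
    hiA (Finset.mem_singleton.1 (planeFlips_subset _ _ h) ▸ hj)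
  have hS : ∀ j ∈ A, j ∉ planeSigns (P.plane i) i := fun j hj h =>
    hiA (Finset.mem_singleton.1 (planeSigns_subset _ _ h) ▸ hj)
  refine ⟨symmDiff (planeFlips (P.plane i) i) K, symmDiff (planeSigns (P.plane i) i) L,
    fun v hv hvA => ?_, ?_, ?_, fun ψ hψ => ?_⟩
  · have h1 := hK v (by simp [hvA])
    have h2 := hL v (by simp [hvA])
    have h3 := hF v hvA
    have h4 := hS v hvA
    simp only [Finset.mem_symmDiff] at hv
    tauto
  · have := hK i (by simp)
    simp only [Finset.mem_symmDiff]; tauto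
  · have := hL i (by simp)
    simp only [Finset.mem_symmDiff]; tauto
  -- The constant norm comes from strong determinism of the full pattern; the stage itself is only
  -- known to be deterministic.
  have hN : ∀ α : V → ℝ, (∀ j, α j ∈ Set.Icc 0 Real.pi) →
      sqNorm (contractList (bra P.plane α fun _ => false) (A ++ [i])
        (graphVec P.graph P.inputs ψ)) = 1 := by
    refine sqNorm_contractList_of_append _ _ B _ (hm' ▸ hnod) fun α hα => ?_
    rw [← hm']
    obtain ⟨h1, h2, -⟩ := hdet α fun j _ => hα j
    exact sqNorm_contractList_measured hP h1 h2 hψ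
  obtain ⟨ω, hω, hω'⟩ := exists_planeBra_true (V := V) (P.plane i)
  have key : ∃ c : ℂ, planePauli (P.plane i) i (pauli K L (graphVec P.graph P.inputs ψ)) =
      c • graphVec P.graph P.inputs ψ := by
    refine eigen_of_contractList P.plane i A hnodA hK hL _ one_ne_zero hN fun α hα => ?_
    have hstage : Q.Deterministic α := (hdet α fun j _ => hα j).2.2 _ (by omega) (by simp [hm])
    have hne : Q.branchMap α (fun _ => false) *ᵥ ψ ≠ 0 := by
      intro h0
      refine ne_zero_of_sqNorm one_ne_zero (hN α hα) (funext fun x => ?_)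
      have h1 := branchMap_false_mulVec hQr α ψ x
      rw [hQm, hQg] at h1
      refine h1.symm.trans ?_
      rw [h0]; rfl
    obtain ⟨c, hc⟩ := branch_parallel hstage hψ t _ hne
    have hbranch : contractList (bra P.plane α (Q.extend t)) (A ++ [i])
          (ε • pauli K L (graphVec P.graph P.inputs ψ)) =
        c • contractList (bra P.plane α fun _ => false) (A ++ [i])
          (graphVec P.graph P.inputs ψ) := by
      funext x
      have h0 := branchMap_false_mulVec hQr α ψ x
      have h1 := branchMap_mulVec Q hQr α t ψ x
      rw [hQm, hQg] at h0
      rw [hQm, hrun, entSign_eq_graphSign Q hQr, hQg, hc, Pi.smul_apply] at h1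
      refine h1.symm.trans ?_
      rw [Pi.smul_apply]
      exact congrArg _ h0
    have hlist : ∀ w, contractList (bra P.plane α (Q.extend t)) (A ++ [i]) w =
        ω • contractList (bra P.plane α fun _ => false) (A ++ [i])
          (planePauli (P.plane i) i w) := by
      intro w
      rw [contractList_append, contractList_append, contractList, contractList, contractList,
        contractList, bra_eq, bra_eq, ht]
      simp only [decide_true]
      rw [hω', planePauli, planePauli,
        pauli_contractList _ hF hS]
      rw [contractList_congr (ν := bra P.plane α fun _ => false) fun j hj => ?_]
      have : j ≠ i := by rintro rfl; exact hiA hj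
      rw [bra_eq, bra_eq]; simp [this]
    rw [hlist, planePauli, pauli_smul, contractList_smul, smul_smul] at hbranch
    refine ⟨(ω * ε)⁻¹ * c, ?_⟩
    rw [← smul_smul, ← hbranch, smul_smul, inv_mul_cancel₀ (mul_ne_zero hω hε), one_smul]
    rfl
  obtain ⟨c, hc⟩ := key
  rw [planePauli, pauli_pauli] at hc
  refine ⟨(chi L (flip (planeFlips (P.plane i) i) fun _ => false))⁻¹ * c, ?_⟩
  rw [← smul_smul, ← hc, smul_smul, inv_mul_cancel₀ (chi_ne_zero _ _), one_smul]

/-- The strict order by ranks. -/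
abbrev rankOrder (r : V → ℕ) : PartialOrder V where
  le a b := a = b ∨ r a < r b
  lt a b := r a < r b
  le_refl a := Or.inl rfl
  le_trans a b c := by
    rintro (rfl | h) (rfl | h')
    · exact Or.inl rfl
    · exact Or.inr h'
    · exact Or.inr h
    · exact Or.inr (h.trans h')
  lt_iff_le_not_ge a b := by
    constructor
    · intro h
      refine ⟨Or.inr h, ?_⟩
      rintro (rfl | h')
      · exact lt_irrefl _ h
      · exact lt_asymm h h'
    · rintro ⟨rfl | h, h'⟩
      · exact absurd (Or.inl rfl) h'
      · exact h
  le_antisymm a b := by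
    rintro (rfl | h) (h' | h')
    · rfl
    · rfl
    · exact h'.symm
    · exact absurd h' (lt_asymm h)

theorem hasGFlow (hP : P.Runnable) (hdet : P.UniformlyStronglyStepwiseDeterministic) :
    HasGFlow P.graph P.inputs P.outputs P.plane := by
  have H : ∀ i : {i // i ∉ P.outputs}, ∃ K : Finset V, (∀ v ∈ K, v ∉ P.inputs) ∧
      (∀ v, v ∈ K ∨ v ∈ oddNbhd P.graph K → v ≠ i.1 →
        P.measured.idxOf i.1 < P.measured.idxOf v) ∧
      (i.1 ∈ K ↔ i.1 ∈ planeFlips (P.plane i.1) i.1) ∧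
      (i.1 ∈ oddNbhd P.graph K ↔ i.1 ∈ planeSigns (P.plane i.1) i.1) := by
    rintro ⟨i, hi⟩
    obtain ⟨A, B, hm⟩ := List.append_of_mem ((mem_measured hP i).2 hi)
    obtain ⟨K, L, h1, h2, h3, h4⟩ := exists_correction hP hdet hm
    obtain ⟨h5, h6⟩ := stabilizer_of_eigen h4
    refine ⟨K, h5, fun v hv hvi => ?_, h2, (h6 i).symm.trans h3⟩
    have hiA : i ∉ A := by
      have hn := measured_nodup hP
      rw [hm, List.nodup_append] at hn
      exact fun h => hn.2.2 i h i (by simp) rfl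
    have hvA : v ∉ A := h1 v (by rwa [h6])
    rw [hm, List.idxOf_append_of_notMem hiA, List.idxOf_append_of_notMem hvA,
      List.idxOf_cons_self, List.idxOf_cons_ne _ (Ne.symm hvi)]
    omega
  choose g h1 h2 h3 h4 using H
  -- All outputs share the largest rank, hence are mutually incomparable and above every measured
  -- qubit.
  refine ⟨g, rankOrder fun v => P.measured.idxOf v, h1, fun i j hj hij => ?_,
    fun i j hle hij hj => ?_,
    fun i hl => ?_, fun i hl => ?_, fun i hl => ?_⟩
  · exact h2 i j (Or.inl hj) (Ne.symm hij)
  · rcases hle with h | h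
    · exact hij h.symm
    · exact lt_asymm h (h2 i j (Or.inr hj) (Ne.symm hij))
  all_goals
    rw [h3, h4, hl]
    simp [planeFlips, planeSigns]

end Flow

/-! ### The branch maps as a rescaled isometry. -/

section Realization

/-- After rescaling from unit vectors, complex polarization applies: a complex operator with zero
quadratic form is zero. -/
theorem eq_one_of_quadratic_form {ι : Type*} [Fintype ι] [DecidableEq ι] {M : Matrix ι ι ℂ}
    (h : ∀ ψ : ι → ℂ, star ψ ⬝ᵥ ψ = 1 → star ψ ⬝ᵥ (M *ᵥ ψ) = 1) : M = 1 := by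
  have hall : ∀ ψ : ι → ℂ, star ψ ⬝ᵥ (M *ᵥ ψ) = star ψ ⬝ᵥ ψ := by
    intro ψ
    by_cases h0 : ψ = 0
    · simp [h0]
    have hr : star ψ ⬝ᵥ ψ = ((∑ y, Complex.normSq (ψ y) : ℝ) : ℂ) := by
      rw [dotProduct_comm, dotProduct_star_self_eq]
    set r : ℝ := ∑ y, Complex.normSq (ψ y)
    have hpos : 0 < r := by
      obtain ⟨x, hx⟩ := Function.ne_iff.1 h0
      exact Finset.sum_pos' (fun y _ => Complex.normSq_nonneg _)
        ⟨x, Finset.mem_univ x, Complex.normSq_pos.2 hx⟩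
    have hs : ((Real.sqrt r : ℝ) : ℂ) ≠ 0 := by
      rw [Complex.ofReal_ne_zero]; exact (Real.sqrt_pos.2 hpos).ne'
    have hrr : ((Real.sqrt r : ℝ) : ℂ) * ((Real.sqrt r : ℝ) : ℂ) = (r : ℂ) := by
      rw [← Complex.ofReal_mul, Real.mul_self_sqrt hpos.le]
    have hstar : star (((Real.sqrt r : ℝ) : ℂ)⁻¹ • ψ) = ((Real.sqrt r : ℝ) : ℂ)⁻¹ • star ψ := by
      rw [star_smul, ← Complex.ofReal_inv, Complex.star_def, Complex.conj_ofReal]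
    have := h (((Real.sqrt r : ℝ) : ℂ)⁻¹ • ψ) (by
      rw [hstar, smul_dotProduct, dotProduct_smul, hr, ← hrr, smul_eq_mul, smul_eq_mul]
      field_simp)
    rw [hstar, smul_dotProduct, Matrix.mulVec_smul, dotProduct_smul, smul_eq_mul,
      smul_eq_mul] at this
    rw [hr, ← hrr]
    field_simp at this
    rw [this]; ring
  have hT : Matrix.toEuclideanLin (M - 1) = 0 := by
    refine (inner_map_self_eq_zero _).1 fun x => ?_
    rw [← inner_conj_symm, EuclideanSpace.inner_eq_star_dotProduct, Matrix.ofLp_toLpLin,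
      Matrix.toLin'_apply, dotProduct_comm, Matrix.sub_mulVec, Matrix.one_mulVec, dotProduct_sub, hall, sub_self, map_zero]
  exact sub_eq_zero.1 ((LinearEquiv.map_eq_zero_iff _).1 hT)

variable {V : Type*} [Fintype V] [DecidableEq V] {P : Pattern V}

theorem branchMap_false_eq (hP : P.Runnable) (α : V → ℝ) :
    P.branchMap α (fun _ => false) =
      graphEmbedding P.graph P.inputs P.outputs P.plane α := by
  refine Matrix.ext_of_mulVec_single fun z => funext fun y => ?_
  have hL : P.measured.toFinset = P.outputsᶜ := by
    ext i; simp [mem_measured hP]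
  have hy : y = fun i : P.outputs => padString P.outputs y i := by
    funext i; simp [padString]
  rw [hy, branchMap_false_mulVec hP, graphEmbedding_mulVec _ _ _ _ _ _ (measured_nodup hP) hL]

theorem card_outcomes (P : Pattern V) : Fintype.card P.Outcomes = 2 ^ P.outputsᶜ.card := by
  rw [Fintype.card_fun, Fintype.card_bool, Fintype.card_subtype]
  congr 2
  ext i; simp

theorem realizes (hP : P.Runnable) {α : V → ℝ} (h : P.Deterministic α)
    (h' : P.StronglyDeterministic α) :
    P.Realizes α (((Real.sqrt 2 : ℝ) : ℂ) ^ (P.outputsᶜ.card) •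
      graphEmbedding P.graph P.inputs P.outputs P.plane α) := by
  rw [← branchMap_false_eq hP]
  set U := P.branchMap α fun _ => false with hU
  set r : ℂ := ((Real.sqrt 2 : ℝ) : ℂ) ^ (P.outputsᶜ.card) with hr
  have hstar : star r = r := by
    rw [hr, star_pow, Complex.star_def, Complex.conj_ofReal]
  -- The scaling is chosen so that its square is the number of branches, each contributing the same
  -- `U ρ U†`.
  have hrr : r * r = Fintype.card P.Outcomes := by
    rw [hr, card_outcomes, ← mul_pow, ← Complex.ofReal_mul, Real.mul_self_sqrt zero_le_two]
    simp
  constructor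
  · refine eq_one_of_quadratic_form fun ψ hψ => ?_
    have h1 := sum_normSq_branch h hψ
    rw [Finset.sum_congr rfl fun s _ => Finset.sum_congr rfl fun y _ =>
      normSq_branch_eq h' ψ s (fun _ => false) y, Finset.sum_const, Finset.card_univ,
      nsmul_eq_mul] at h1
    have h2 : star ψ ⬝ᵥ ((Uᴴ * U) *ᵥ ψ) = ((∑ y, Complex.normSq ((U *ᵥ ψ) y) : ℝ) : ℂ) := by
      rw [← dotProduct_star_self_eq, ← Matrix.mulVec_mulVec, Matrix.dotProduct_mulVec,
        ← Matrix.star_mulVec, dotProduct_comm]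
    rw [Matrix.conjTranspose_smul, Matrix.smul_mul, Matrix.mul_smul, smul_smul, hstar, hrr,
      Matrix.smul_mulVec, dotProduct_smul, h2, smul_eq_mul]
    exact_mod_cast h1
  · intro ρ
    have hs : ∀ s, P.branchMap α s * ρ * (P.branchMap α s)ᴴ = U * ρ * Uᴴ := by
      intro s
      obtain ⟨θ, hθ⟩ := h' s fun _ => false
      have hone : Complex.exp (Complex.I * θ) * star (Complex.exp (Complex.I * θ)) = 1 := by
        rw [Complex.star_def, Complex.mul_conj, Complex.normSq_eq_norm_sq, mul_comm Complex.I,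
          Complex.norm_exp_ofReal_mul_I]
        simp
      rw [hθ, Matrix.conjTranspose_smul, Matrix.smul_mul, Matrix.smul_mul, Matrix.mul_smul,
        smul_smul, hone, one_smul]
    rw [Pattern.channel, Finset.sum_congr rfl fun s _ => hs s, Finset.sum_const, Finset.card_univ,
      Matrix.conjTranspose_smul, hstar, Matrix.smul_mul, Matrix.smul_mul, Matrix.mul_smul,
      smul_smul, hrr, Nat.cast_smul_eq_nsmul]

end Realization

end MBQC

end

theorem theorem3 {V : Type*} [Fintype V] [DecidableEq V] (P : MBQC.Pattern V)
    (hrun : P.Runnable) (hdet : P.UniformlyStronglyStepwiseDeterministic) :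
    MBQC.HasGFlow P.graph P.inputs P.outputs P.plane ∧
      ∀ α : V → ℝ, P.AdmissibleAngles α →
        P.Realizes α (((Real.sqrt 2 : ℝ) : ℂ) ^ (P.outputsᶜ.card) •
          MBQC.graphEmbedding P.graph P.inputs P.outputs P.plane α) ∧
        ∀ s : P.Outcomes, ∃ θ : ℝ,
          P.branchMap α s = Complex.exp (Complex.I * θ) •
            MBQC.graphEmbedding P.graph P.inputs P.outputs P.plane α := by
  refine ⟨MBQC.hasGFlow hrun hdet, fun α hα => ?_⟩
  obtain ⟨h1, h2, -⟩ := hdet α hα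
  refine ⟨MBQC.realizes hrun h1 h2, fun s => ?_⟩
  rw [← MBQC.branchMap_false_eq hrun]
  exact h2 s _
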